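/- Let $\gamma\in(0,\infty)$ and let $\nu$ be a probability measure on $\mathbb R$ whose support is a compact subset of $(0,\infty)$. Let $\mu$ be the associated limiting spectral distribution of large complex correlated Wishart matrices, that is, the probability measure on $\mathbb R$ whose Cauchy transform $m(z)=\int (z-\lambda)^{-1}\,\mu(d\lambda)$ satisfies, for every $z\in\mathbb C_+=\{z\in\mathbb C:\operatorname{Im} z>0\}$, $$ m(z)=\Bigl(z-\gamma\int\frac{\lambda}{1-m(z)\lambda}\,\nu(d\lambda)\Bigr)^{-1}. $$ For real $x\neq 0$ let $m(x)=\lim_{z\in\mathbb C_+,\,z\to x}m(z)$ and let $\rho(x)=-\frac1\pi\operatorname{Im} m(x)$ be the density of $\mu$ on $\mathbb R\setminus\{0\}$. Put $$ D=\{x\in\mathbb R:\ x\ne 0,\ x^{-1}\notin\operatorname{supp}(\nu)\},\qquad g(x)=\frac1x+\gamma\int\frac{\lambda}{1-x\lambda}\,\nu(d\lambda)\quad (x\in D). $$ A real number $a$ is called a cusp point if $\rho(a)=0$ and, for every $\delta>0$ small enough, $\int_{a-\delta}^{a}\rho(x)\,dx>0$ and $\int_{a}^{a+\delta}\rho(x)\,dx>0$.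 Let $a$ be a cusp point, set $c=m(a)$, and assume that $c\in D$. Then $g(c)=a$, $g'(c)=0$, $g''(c)=0$ and $g'''(c)>0$; moreover, $$ \rho(x)=\frac{\sqrt3}{2\pi}\Bigl(\frac{6}{g'''(c)}\Bigr)^{1/3}|x-a|^{1/3}\,(1+o(1)),\qquad x\to a. \qquad (*)$$ Conversely, if $c\in D$ satisfies $g'(c)=g''(c)=0$, then the real number $a=g(c)$ is a cusp point, $g'''(c)>0$, and $(*)$ holds. -/

import Mathlib

open MeasureTheory Filter Topology Asymptotics

noncomputable section

namespace WishartCusp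

/-- The Cauchy transform `m(z) = ∫ (z - t)⁻¹ μ(dt)` of a measure on the real line. -/
def cauchyTransform (μ : Measure ℝ) (z : ℂ) : ℂ :=
  ∫ t : ℝ, (z - (t : ℂ))⁻¹ ∂μ

/-- The open upper half-plane, as a set of complex numbers. -/
def upperHalf : Set ℂ := {z : ℂ | 0 < z.im}

/-- Admissible limiting spectral measures of the population covariance matrices: probability
measures whose support is a compact subset of `(0, ∞)`. -/
structure IsPopulationLaw (ν : Measure ℝ) : Prop where
  isProbabilityMeasure : IsProbabilityMeasure ν
  isCompact_support : IsCompact ν.support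
  support_subset : ν.support ⊆ Set.Ioi 0

/-- `μ` is the limiting spectral distribution attached to `γ` and `ν`: the probability measure
whose Cauchy transform `m` solves the Marchenko-Pastur fixed-point equation
`m = (z - γ ∫ t / (1 - m t) ν(dt))⁻¹` at each point `z` of the upper half-plane. -/
structure IsLimitingSpectralLaw (γ : ℝ) (ν μ : Measure ℝ) : Prop where
  isProbabilityMeasure : IsProbabilityMeasure μ
  fixed_point : ∀ z ∈ upperHalf,
    cauchyTransform μ z =
      (z - (γ : ℂ) * ∫ t : ℝ, (t : ℂ) / (1 - cauchyTransform μ z * (t : ℂ)) ∂ν)⁻¹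

/-- The extension of the Cauchy transform to the (nonzero) real axis:
`m(x)` is the limit of `m(z)` as `z → x` in the upper half-plane. -/
def boundaryCauchy (μ : Measure ℝ) (x : ℝ) : ℂ :=
  limUnder (𝓝[upperHalf] (x : ℂ)) (cauchyTransform μ)

/-- The density `ρ(x) = - π⁻¹ Im m(x)`. -/
def density (μ : Measure ℝ) (x : ℝ) : ℝ :=
  -(Real.pi)⁻¹ * (boundaryCauchy μ x).im

/-- `g(x) = 1 / x + γ ∫ t / (1 - x t) ν(dt)`, for real `x`. -/
def g (γ : ℝ) (ν : Measure ℝ) (x : ℝ) : ℝ :=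
  1 / x + γ * ∫ t : ℝ, t / (1 - x * t) ∂ν

/-- The set `D` of nonzero real `x` with `x⁻¹` outside the support of `ν`. -/
def domainD (ν : Measure ℝ) : Set ℝ :=
  {x : ℝ | x ≠ 0 ∧ x⁻¹ ∉ ν.support}

/-- `a` is a cusp point: `ρ(a) = 0` and, for every small enough `δ > 0`, `ρ` has positive mass
both on `[a - δ, a]` and on `[a, a + δ]`. -/
def IsCuspPoint (μ : Measure ℝ) (a : ℝ) : Prop :=
  density μ a = 0 ∧
    ∀ᶠ δ in 𝓝[>] (0 : ℝ),
      0 < (∫ x in (a - δ)..a, density μ x) ∧ 0 < (∫ x in a..(a + δ), density μ x)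

/-- Cube-root behaviour of the density at `a`, with the constant attached to `g'''(c)`:
`ρ(x) = (√3 / 2π) (6 / g'''(c))^{1/3} |x - a|^{1/3} (1 + o(1))` as `x → a`. -/
def CubeRootBehaviour (γ : ℝ) (ν μ : Measure ℝ) (a c : ℝ) : Prop :=
  density μ ~[𝓝 a] fun x : ℝ =>
    Real.sqrt 3 / (2 * Real.pi) * (6 / iteratedDeriv 3 (g γ ν) c) ^ (1 / 3 : ℝ)
      * |x - a| ^ (1 / 3 : ℝ)

end WishartCusp

end

/-!
The fixed-point equation says that `G(m(z)) = z` on the upper half-plane, where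
`G(m) = 1 / m + γ ∫ t / (1 - m t) ν(dt)` extends `g` to complex arguments. The density near a point
`a` with `m(a) = c ∈ D` is therefore read off from the Taylor expansion of `G` at `c`, once it is
known which of the preimages of `x` under `G` is the boundary value `m(x)`. Two facts about pairs
`(m, z)` with `G(m) = z`, `Im m < 0 < Im z` decide this.

* The divided difference `Φ(m) = (G(m) - G(m̄)) / (m - m̄)` is real and negative, since
  `Im G(m) = Im m · Φ(m)` (`inverseMap_im`). In the limit on the real axis `Φ(m(x)) ≤ 0`, with
  equality wherever `m(x)` is not real.
* `|m - m'| ^ 3 ≤ K |z - z'|` for two such pairs with `m`, `m'` bounded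
  (`IsInversePair.norm_sub_pow_three_le`). Indeed, with `u = m t / (1 - m t)` and
  `v = m' t / (1 - m' t)`, negativity of `Φ` means that `u` and `v̄` lie in the unit ball of
  `L²(γ ν)`, while `z = z'` and `m ≠ m'` would force their inner product to be `1`; the
  parallelogram identity turns this into a bound of `u - v̄`, hence of `m - m'`. So the boundary
  values of the Cauchy transform exist and are continuous off the origin, and a point `m` of the
  lower half-plane is a value of the Cauchy transform as soon as `Im G(m) > 0`.

Near `c` write `m(x) = c + w` with `w = p + i q`, and let `A₁`, `A₂`, `A₃` be the Taylor
coefficients of `G` at `c`. Then `x - a = A₁ w + A₂ w² + A₃ w³ + O(w⁴)` and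
`Φ = A₁ + 2 A₂ p + A₃ (3 p² - q²) + O(|w|³)` (`exists_expansion`). At a cusp there are nonreal
values `m(x)` with `x` arbitrarily close to `a` on both sides. As `Φ` vanishes there, `A₁ = 0`. If
`A₂ ≠ 0`, then `p = O(|w|²)`, so that `x - a`, being about `-A₂ q²`, could have one sign only;
hence `A₂ = 0`. The coefficients are moments of an explicit signed measure (`poleMoment`),
and `A₁ = A₂ = 0` makes `A₃` the integral of a positive function (`poleMoment_four_pos`).
Finally `q² = 3 p²` and `x - a = A₃ Re w³` to leading order, which is the cube-root law
(`IsBoundaryInverse.isEquivalent`).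

Conversely, if `g'(c) = g''(c) = 0`, then `Im G(c - i r) > 0` for small `r > 0`, so the Cauchy
transform takes the value `c - i r` and `m(g(c)) = c`; real values `m(x) ≠ c` near `c` are excluded
because `Φ(c + p)` is about `3 A₃ p² > 0`.

The boundary values are defined through `limUnder`, so their existence matters also for the first
implication. The origin, where the limit need not exist, is not a cusp because the density vanishes
on the negative axis (`IsCuspPoint.ne_zero`).
-/

namespace WishartCusp

/-! ### The inverse map of the Cauchy transform -/

/-- The map `G(m) = 1 / m + γ ∫ t / (1 - m t) ν(dt)` of a complex variable, which extends `g` and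
is inverted by the Cauchy transform of the limiting law. -/
noncomputable def inverseMap (γ : ℝ) (ν : Measure ℝ) (m : ℂ) : ℂ :=
  m⁻¹ + (γ : ℂ) * ∫ t : ℝ, (t : ℂ) / (1 - m * (t : ℂ)) ∂ν

/-- The divided difference `(G(m) - G(m̄)) / (m - m̄) = γ ∫ t² / |1 - m t|² ν(dt) - 1 / |m|²`,
written so that it makes sense for real `m` too: on `D` it is `g'(m)`. -/
noncomputable def conjSlope (γ : ℝ) (ν : Measure ℝ) (m : ℂ) : ℝ :=
  γ * (∫ t : ℝ, t ^ 2 / Complex.normSq (1 - m * (t : ℂ)) ∂ν) - (Complex.normSq m)⁻¹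

/-- `(m, z)` is on the graph of `G` restricted to the lower half-plane, over the upper one. -/
structure IsInversePair (γ : ℝ) (ν : Measure ℝ) (m z : ℂ) : Prop where
  im_neg : m.im < 0
  im_pos : 0 < z.im
  map_eq : inverseMap γ ν m = z

variable {γ : ℝ} {ν μ : Measure ℝ}

lemma integral_pos_of_ae_pos {α : Type*} {mα : MeasurableSpace α} {P : Measure α} [NeZero P]
    {f : α → ℝ} (hf : Integrable f P) (hpos : ∀ᵐ t ∂P, 0 < f t) : 0 < ∫ t, f t ∂P := by
  rw [integral_pos_iff_support_of_nonneg_ae (hpos.mono fun t ht => ht.le) hf, pos_iff_ne_zero]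
  intro h0
  obtain ⟨t, ht, ht'⟩ := ((measure_eq_zero_iff_ae_notMem.1 h0).and hpos).exists
  exact ht (Function.mem_support.2 ht'.ne')

namespace IsPopulationLaw

lemma ae_mem_support : ∀ᵐ t ∂ν, t ∈ ν.support :=
  Measure.support_mem_ae

lemma ae_pos (hν : IsPopulationLaw ν) : ∀ᵐ t ∂ν, 0 < t := by
  filter_upwards [ae_mem_support] with t ht using hν.support_subset ht

lemma integrable_of_continuousOn {E : Type*} [NormedAddCommGroup E]
    (hν : IsPopulationLaw ν) {f : ℝ → E} (hf : ContinuousOn f ν.support) : Integrable f ν := by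
  have := hν.isProbabilityMeasure
  have h := hf.integrableOn_compact (μ := ν) hν.isCompact_support
  rwa [IntegrableOn, Measure.restrict_eq_self_of_ae_mem ae_mem_support] at h

lemma integral_pos_of_pos (hν : IsPopulationLaw ν) {f : ℝ → ℝ} (hf : ContinuousOn f ν.support)
    (hpos : ∀ t ∈ ν.support, 0 < f t) : 0 < ∫ t, f t ∂ν := by
  have := hν.isProbabilityMeasure
  exact integral_pos_of_ae_pos (hν.integrable_of_continuousOn hf)
    (by filter_upwards [ae_mem_support] with t ht using hpos t ht)

end IsPopulationLaw

lemma one_sub_mul_ofReal_ne_zero {m : ℂ} (hm : m.im ≠ 0) (t : ℝ) : 1 - m * (t : ℂ) ≠ 0 := by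
  intro h
  have him := congrArg Complex.im h
  have hre := congrArg Complex.re h
  simp [hm] at him
  simp [him] at hre

lemma continuousOn_div_one_sub {m : ℂ} {s : Set ℝ} (hm : ∀ t ∈ s, 1 - m * (t : ℂ) ≠ 0) :
    ContinuousOn (fun t : ℝ => (t : ℂ) / (1 - m * (t : ℂ))) s :=
  ContinuousOn.div (by fun_prop) (by fun_prop) hm

/-- The identity `Im G(m) = Im m · (G(m) - G(m̄)) / (m - m̄)`. -/
lemma inverseMap_im (hν : IsPopulationLaw ν) {m : ℂ} (hm : m.im ≠ 0) :
    (inverseMap γ ν m).im = m.im * conjSlope γ ν m := by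
  have hint := hν.integrable_of_continuousOn
    (continuousOn_div_one_sub fun t _ => one_sub_mul_ofReal_ne_zero hm t)
  have h : (∫ t : ℝ, (t : ℂ) / (1 - m * (t : ℂ)) ∂ν).im
      = m.im * ∫ t : ℝ, t ^ 2 / Complex.normSq (1 - m * (t : ℂ)) ∂ν := by
    rw [← integral_const_mul]
    refine (integral_im (𝕜 := ℂ) hint).symm.trans (integral_congr_ae (ae_of_all _ fun t => ?_))
    simp [Complex.div_im]
    ring
  rw [inverseMap, conjSlope, Complex.add_im, Complex.im_ofReal_mul, h, Complex.inv_im]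
  ring

/-- Taking imaginary parts in `m G(m) = 1 + γ ∫ m t / (1 - m t) ν(dt)`. -/
lemma im_mul_inverseMap (hν : IsPopulationLaw ν) {m : ℂ} (hm : m.im ≠ 0) :
    (m * inverseMap γ ν m).im
      = γ * m.im * ∫ t : ℝ, t / Complex.normSq (1 - m * (t : ℂ)) ∂ν := by
  have hne : ∀ t ∈ ν.support, 1 - m * (t : ℂ) ≠ 0 :=
    fun t _ => one_sub_mul_ofReal_ne_zero hm t
  have hm0 : m ≠ 0 := fun h => hm (by simp [h])
  have hint := hν.integrable_of_continuousOn (continuousOn_div_one_sub hne)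
  have h : (∫ t : ℝ, m * ((t : ℂ) / (1 - m * (t : ℂ))) ∂ν).im
      = m.im * ∫ t : ℝ, t / Complex.normSq (1 - m * (t : ℂ)) ∂ν := by
    rw [← integral_const_mul]
    refine (integral_im (𝕜 := ℂ) (hint.const_mul m)).symm.trans
      (integral_congr_ae (ae_of_all _ fun t => ?_))
    simp [Complex.div_im, Complex.div_re]
    ring
  rw [inverseMap, mul_add, mul_inv_cancel₀ hm0, mul_left_comm, ← integral_const_mul,
    Complex.add_im, Complex.im_ofReal_mul, h]
  simp [mul_assoc]

lemma inverseMap_sub (hν : IsPopulationLaw ν) {m m' : ℂ} (hm : m.im ≠ 0) (hm' : m'.im ≠ 0) :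
    (inverseMap γ ν m - inverseMap γ ν m') * (m * m')
      = -(m - m') * (1 - (γ : ℂ) * ∫ t : ℝ, m * (t : ℂ) / (1 - m * (t : ℂ))
          * (m' * (t : ℂ) / (1 - m' * (t : ℂ))) ∂ν) := by
  have hm0 : m ≠ 0 := fun h => hm (by simp [h])
  have hm0' : m' ≠ 0 := fun h => hm' (by simp [h])
  have hint := hν.integrable_of_continuousOn
    (continuousOn_div_one_sub fun t _ => one_sub_mul_ofReal_ne_zero hm t)
  have hint' := hν.integrable_of_continuousOn
    (continuousOn_div_one_sub fun t _ => one_sub_mul_ofReal_ne_zero hm' t)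
  have h : (m - m') * ∫ t : ℝ, m * (t : ℂ) / (1 - m * (t : ℂ))
          * (m' * (t : ℂ) / (1 - m' * (t : ℂ))) ∂ν
      = ((∫ t : ℝ, (t : ℂ) / (1 - m * (t : ℂ)) ∂ν)
        - ∫ t : ℝ, (t : ℂ) / (1 - m' * (t : ℂ)) ∂ν) * (m * m') := by
    rw [← integral_sub hint hint', ← integral_const_mul, ← integral_mul_const]
    refine integral_congr_ae (ae_of_all _ fun t => ?_)
    have h1 := one_sub_mul_ofReal_ne_zero hm t
    have h2 := one_sub_mul_ofReal_ne_zero hm' t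
    simp only
    field_simp
    ring
  have : (m⁻¹ - m'⁻¹) * (m * m') = -(m - m') := by field_simp; ring
  simp only [inverseMap]
  linear_combination this - (γ : ℂ) * h

namespace IsInversePair

variable {m z m' z' : ℂ}

lemma ne_zero (h : IsInversePair γ ν m z) : m ≠ 0 := fun h0 => by
  simpa [h0] using h.im_neg

lemma conjSlope_neg (hν : IsPopulationLaw ν) (h : IsInversePair γ ν m z) :
    conjSlope γ ν m < 0 := by
  have h1 := inverseMap_im (γ := γ) hν h.im_neg.ne
  rw [h.map_eq] at h1
  nlinarith [h.im_pos, h.im_neg]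

/-- With `u = m t / (1 - m t)`, the condition `Im G(m) > 0` says `γ ∫ |u|² ν(dt) < 1`. -/
lemma integral_normSq_lt (hν : IsPopulationLaw ν) (h : IsInversePair γ ν m z) :
    γ * ∫ t : ℝ, Complex.normSq (m * (t : ℂ) / (1 - m * (t : ℂ))) ∂ν < 1 := by
  have h1 := h.conjSlope_neg hν
  have hm : 0 < Complex.normSq m := Complex.normSq_pos.2 h.ne_zero
  have : ∫ t : ℝ, Complex.normSq (m * (t : ℂ) / (1 - m * (t : ℂ))) ∂ν
      = Complex.normSq m * ∫ t : ℝ, t ^ 2 / Complex.normSq (1 - m * (t : ℂ)) ∂ν := by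
    rw [← integral_const_mul]
    refine integral_congr_ae (ae_of_all _ fun t => ?_)
    simp [Complex.normSq_ofReal]
    ring
  rw [this]
  rw [conjSlope, sub_neg] at h1
  calc _ = Complex.normSq m *
        (γ * ∫ t : ℝ, t ^ 2 / Complex.normSq (1 - m * (t : ℂ)) ∂ν) := by ring
    _ < Complex.normSq m * (Complex.normSq m)⁻¹ := by gcongr
    _ = 1 := mul_inv_cancel₀ hm.ne'

end IsInversePair

lemma continuousOn_mul_div_one_sub {m : ℂ} {s : Set ℝ} (hm : ∀ t ∈ s, 1 - m * (t : ℂ) ≠ 0) :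
    ContinuousOn (fun t : ℝ => m * (t : ℂ) / (1 - m * (t : ℂ))) s :=
  ContinuousOn.div (by fun_prop) (by fun_prop) hm

lemma integrable_normSq (hν : IsPopulationLaw ν) {m : ℂ} (hm : m.im ≠ 0) :
    Integrable (fun t : ℝ => Complex.normSq (m * (t : ℂ) / (1 - m * (t : ℂ)))) ν :=
  hν.integrable_of_continuousOn (Complex.continuous_normSq.comp_continuousOn
    (continuousOn_mul_div_one_sub fun t _ => one_sub_mul_ofReal_ne_zero hm t))

namespace IsInversePair

variable {m z m' z' : ℂ}

/-- From `m z - 1 = γ ∫ u ν(dt)` with `u = m t / (1 - m t)` and `γ ∫ |u|² ν(dt) < 1`. -/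
lemma norm_mul_sub_one_le (hγ : 0 < γ) (hν : IsPopulationLaw ν) (h : IsInversePair γ ν m z) :
    ‖m * z - 1‖ ≤ (γ + 1) / 2 := by
  have := hν.isProbabilityMeasure
  have hne : ∀ t ∈ ν.support, 1 - m * (t : ℂ) ≠ 0 :=
    fun t _ => one_sub_mul_ofReal_ne_zero h.im_neg.ne t
  have hc := continuousOn_mul_div_one_sub hne
  have hint := hν.integrable_of_continuousOn hc
  have hint2 := integrable_normSq hν h.im_neg.ne
  have h1 : m * z - 1 = γ * ∫ t : ℝ, m * (t : ℂ) / (1 - m * (t : ℂ)) ∂ν := by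
    rw [← h.map_eq, inverseMap, mul_add, mul_inv_cancel₀ h.ne_zero, mul_left_comm,
      ← integral_const_mul]
    simp [mul_div_assoc]
  rw [h1, norm_mul, Complex.norm_real, Real.norm_of_nonneg hγ.le]
  have h2 : ‖∫ t : ℝ, m * (t : ℂ) / (1 - m * (t : ℂ)) ∂ν‖
      ≤ ∫ t : ℝ, (1 + Complex.normSq (m * (t : ℂ) / (1 - m * (t : ℂ)))) / 2 ∂ν := by
    refine (norm_integral_le_integral_norm _).trans (integral_mono hint.norm
      (((integrable_const 1).add hint2).div_const 2) fun t => ?_)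
    simp only [Complex.normSq_eq_norm_sq]
    nlinarith [sq_nonneg (‖m * (t : ℂ) / (1 - m * (t : ℂ))‖ - 1)]
  have h3 : ∫ t : ℝ, (1 + Complex.normSq (m * (t : ℂ) / (1 - m * (t : ℂ)))) / 2 ∂ν
      = (1 + ∫ t : ℝ, Complex.normSq (m * (t : ℂ) / (1 - m * (t : ℂ))) ∂ν) / 2 := by
    rw [integral_div, integral_add (integrable_const 1) hint2]
    simp
  have h4 := h.integral_normSq_lt hν
  rw [h3] at h2
  nlinarith

lemma norm_le (hγ : 0 < γ) (hν : IsPopulationLaw ν) (h : IsInversePair γ ν m z) :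
    ‖m‖ ≤ (γ + 3) / 2 / ‖z‖ := by
  have hz : 0 < ‖z‖ := norm_pos_iff.2 fun h0 => by simpa [h0] using h.im_pos
  rw [le_div_iff₀ hz, ← norm_mul]
  calc ‖m * z‖ = ‖(m * z - 1) + 1‖ := by ring_nf
    _ ≤ ‖m * z - 1‖ + ‖(1 : ℂ)‖ := norm_add_le _ _
    _ ≤ (γ + 1) / 2 + 1 := by
      rw [norm_one]
      gcongr
      exact h.norm_mul_sub_one_le hγ hν
    _ = (γ + 3) / 2 := by ring

end IsInversePair

/-- The parallelogram identity `2 Re (u v) = |u|² + |v|² - |u - v̄|²` for `u = m t / (1 - m t)` and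
`v = m' t / (1 - m' t)`, together with a lower bound of `u - v̄`. The latter uses that `m` and `m'`
lie in the same half-plane, so that `|m - m̄'| ≥ |m - m'|`. -/
lemma two_mul_re_mul_le {m m' : ℂ} {M t : ℝ} (hm : m.im < 0) (hm' : m'.im < 0)
    (hM : ‖m‖ ≤ M) (hM' : ‖m'‖ ≤ M) (ht : 0 < t) :
    2 * (m * (t : ℂ) / (1 - m * (t : ℂ)) * (m' * (t : ℂ) / (1 - m' * (t : ℂ)))).re
      ≤ Complex.normSq (m * (t : ℂ) / (1 - m * (t : ℂ)))
        + Complex.normSq (m' * (t : ℂ) / (1 - m' * (t : ℂ)))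
        - ‖m - m'‖ ^ 2 * (t ^ 2 / (1 + M * t) ^ 4) := by
  have hu := one_sub_mul_ofReal_ne_zero hm.ne t
  have hv := one_sub_mul_ofReal_ne_zero hm'.ne t
  have hv' : 1 - (starRingEnd ℂ) m' * (t : ℂ) ≠ 0 :=
    one_sub_mul_ofReal_ne_zero (by simpa using hm'.ne) t
  have key : ∀ u v : ℂ, 2 * (u * v).re
      = Complex.normSq u + Complex.normSq v - Complex.normSq (u - (starRingEnd ℂ) v) := by
    intro u v
    simp [Complex.normSq_apply]
    ring
  rw [key]
  gcongr
  have hdiff : m * (t : ℂ) / (1 - m * (t : ℂ))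
      - (starRingEnd ℂ) (m' * (t : ℂ) / (1 - m' * (t : ℂ)))
      = (m - (starRingEnd ℂ) m') * (t : ℂ) /
        ((1 - m * (t : ℂ)) * (1 - (starRingEnd ℂ) m' * (t : ℂ))) := by
    simp only [map_div₀, map_mul, map_sub, map_one, Complex.conj_ofReal]
    rw [div_sub_div _ _ hu hv']
    ring
  have hM0 : 0 ≤ M := (norm_nonneg m).trans hM
  have hbd : ∀ w : ℂ, ‖w‖ ≤ M → ‖1 - w * (t : ℂ)‖ ≤ 1 + M * t := by
    intro w hw
    refine (norm_sub_le _ _).trans ?_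
    rw [norm_one, norm_mul, Complex.norm_real, Real.norm_of_nonneg ht.le]
    gcongr
  have h1 := hbd m hM
  have h2 := hbd ((starRingEnd ℂ) m') (by simpa using hM')
  have hsub : ‖m - m'‖ ≤ ‖m - (starRingEnd ℂ) m'‖ := by
    rw [← sq_le_sq₀ (norm_nonneg _) (norm_nonneg _), ← Complex.normSq_eq_norm_sq,
      ← Complex.normSq_eq_norm_sq]
    simp only [Complex.normSq_apply, Complex.sub_re, Complex.sub_im, Complex.conj_re,
      Complex.conj_im]
    nlinarith [mul_pos_of_neg_of_neg hm hm']
  rw [hdiff, Complex.normSq_eq_norm_sq, norm_div, norm_mul, norm_mul, Complex.norm_real,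
    Real.norm_of_nonneg ht.le]
  have h3 : 0 < ‖1 - m * (t : ℂ)‖ := norm_pos_iff.2 hu
  have h4 : 0 < ‖1 - (starRingEnd ℂ) m' * (t : ℂ)‖ := norm_pos_iff.2 hv'
  calc ‖m - m'‖ ^ 2 * (t ^ 2 / (1 + M * t) ^ 4)
      = (‖m - m'‖ * t / ((1 + M * t) * (1 + M * t))) ^ 2 := by
        rw [div_pow, mul_pow, mul_pow]; ring
    _ ≤ _ := by gcongr

namespace IsInversePair

variable {m z m' z' : ℂ}

/-- The inverse of `G` is Hölder continuous with exponent `1 / 3` where it is bounded. -/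
lemma norm_sub_pow_three_le (hγ : 0 < γ) (hν : IsPopulationLaw ν) (h : IsInversePair γ ν m z)
    (h' : IsInversePair γ ν m' z') {M : ℝ} (hM : ‖m‖ ≤ M) (hM' : ‖m'‖ ≤ M) :
    ‖m - m'‖ ^ 3 * (γ * ∫ t : ℝ, t ^ 2 / (1 + M * t) ^ 4 ∂ν) ≤ 2 * M ^ 2 * ‖z - z'‖ := by
  have hM0 : 0 ≤ M := (norm_nonneg m).trans hM
  have hne : ∀ t ∈ ν.support, 1 - m * (t : ℂ) ≠ 0 :=
    fun t _ => one_sub_mul_ofReal_ne_zero h.im_neg.ne t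
  have hne' : ∀ t ∈ ν.support, 1 - m' * (t : ℂ) ≠ 0 :=
    fun t _ => one_sub_mul_ofReal_ne_zero h'.im_neg.ne t
  have hu := continuousOn_mul_div_one_sub hne
  have hv := continuousOn_mul_div_one_sub hne'
  have hint := hν.integrable_of_continuousOn (hu.mul hv)
  have hu2 := integrable_normSq hν h.im_neg.ne
  have hv2 := integrable_normSq hν h'.im_neg.ne
  have hk : Integrable (fun t : ℝ => t ^ 2 / (1 + M * t) ^ 4) ν := by
    refine hν.integrable_of_continuousOn (ContinuousOn.div (by fun_prop) (by fun_prop) ?_)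
    intro t ht
    have : 0 < t := hν.support_subset ht
    positivity
  set I := ∫ t : ℝ, m * (t : ℂ) / (1 - m * (t : ℂ))
          * (m' * (t : ℂ) / (1 - m' * (t : ℂ))) ∂ν with hI
  set κ := ∫ t : ℝ, t ^ 2 / (1 + M * t) ^ 4 ∂ν
  have hre : 2 * I.re ≤ (∫ t : ℝ, Complex.normSq (m * (t : ℂ) / (1 - m * (t : ℂ))) ∂ν)
      + (∫ t : ℝ, Complex.normSq (m' * (t : ℂ) / (1 - m' * (t : ℂ))) ∂ν)
      - ‖m - m'‖ ^ 2 * κ := by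
    have e : I.re = ∫ t : ℝ, (m * (t : ℂ) / (1 - m * (t : ℂ))
          * (m' * (t : ℂ) / (1 - m' * (t : ℂ)))).re ∂ν := (integral_re (𝕜 := ℂ) hint).symm
    have huv : Integrable (fun t : ℝ => Complex.normSq (m * (t : ℂ) / (1 - m * (t : ℂ)))
        + Complex.normSq (m' * (t : ℂ) / (1 - m' * (t : ℂ)))) ν := hu2.add hv2
    rw [e, ← integral_const_mul, ← integral_const_mul, ← integral_add hu2 hv2,
      ← integral_sub huv (hk.const_mul _)]
    refine integral_mono_ae (Integrable.const_mul hint.re 2) (huv.sub (hk.const_mul _)) ?_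
    filter_upwards [hν.ae_pos] with t ht using
      two_mul_re_mul_le h.im_neg h'.im_neg hM hM' ht
  have hlow : γ * (‖m - m'‖ ^ 2 * κ) ≤ 2 * ‖1 - (γ : ℂ) * I‖ := by
    have h1 := h.integral_normSq_lt hν
    have h2 := h'.integral_normSq_lt hν
    have h3 : 1 - γ * I.re ≤ ‖1 - (γ : ℂ) * I‖ := by
      simpa using Complex.re_le_norm (1 - (γ : ℂ) * I)
    nlinarith
  have hmain := congrArg norm (inverseMap_sub (γ := γ) hν h.im_neg.ne h'.im_neg.ne)
  rw [h.map_eq, h'.map_eq, ← hI, norm_mul, norm_mul, norm_mul, norm_neg] at hmain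
  calc ‖m - m'‖ ^ 3 * (γ * κ) = ‖m - m'‖ * (γ * (‖m - m'‖ ^ 2 * κ)) := by ring
    _ ≤ ‖m - m'‖ * (2 * ‖1 - (γ : ℂ) * I‖) := by gcongr
    _ = 2 * (‖z - z'‖ * (‖m‖ * ‖m'‖)) := by rw [hmain]; ring
    _ ≤ 2 * (‖z - z'‖ * (M * M)) := by gcongr
    _ = _ := by ring

end IsInversePair

/-- The constant of `IsInversePair.norm_sub_pow_three_le` does not vanish. -/
lemma integral_sq_div_pos (hν : IsPopulationLaw ν) {M : ℝ} (hM : 0 ≤ M) :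
    0 < ∫ t : ℝ, t ^ 2 / (1 + M * t) ^ 4 ∂ν := by
  have hpos : ∀ t ∈ ν.support, 0 < t := fun t ht => hν.support_subset ht
  refine hν.integral_pos_of_pos (ContinuousOn.div (by fun_prop) (by fun_prop) ?_) ?_ <;>
  · intro t ht
    have := hpos t ht
    positivity

/-- `G` is injective on the part of the lower half-plane that it maps to the upper one. -/
lemma IsInversePair.unique {m m' z : ℂ} (hγ : 0 < γ) (hν : IsPopulationLaw ν)
    (h : IsInversePair γ ν m z) (h' : IsInversePair γ ν m' z) : m = m' := by
  have h1 := h.norm_sub_pow_three_le hγ hν h' (le_max_left _ _) (le_max_right ‖m‖ ‖m'‖)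
  have h2 : 0 < γ * ∫ t : ℝ, t ^ 2 / (1 + max ‖m‖ ‖m'‖ * t) ^ 4 ∂ν :=
    mul_pos hγ (integral_sq_div_pos hν (by positivity))
  rw [sub_self, norm_zero, mul_zero] at h1
  have h3 : ‖m - m'‖ ^ 3 = 0 :=
    le_antisymm (nonpos_of_mul_nonpos_left h1 h2) (by positivity)
  simpa [sub_eq_zero] using h3

/-! ### The Cauchy transform and its boundary values -/

lemma cauchyTransform_im_neg {μ : Measure ℝ} [IsProbabilityMeasure μ] {z : ℂ} (hz : 0 < z.im) :
    (cauchyTransform μ z).im < 0 := by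
  have hne : ∀ t : ℝ, z - (t : ℂ) ≠ 0 := fun t h => hz.ne' (by simpa using congrArg Complex.im h)
  have hint : Integrable (fun t : ℝ => (z - (t : ℂ))⁻¹) μ := by
    refine Integrable.of_bound
      (Continuous.inv₀ (by fun_prop) hne).aestronglyMeasurable (z.im)⁻¹ (ae_of_all _ fun t => ?_)
    rw [norm_inv]
    gcongr
    simpa [abs_of_pos hz] using Complex.abs_im_le_norm (z - (t : ℂ))
  have h : (cauchyTransform μ z).im = ∫ t : ℝ, ((z - (t : ℂ))⁻¹).im ∂μ :=
    (integral_im (𝕜 := ℂ) hint).symm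
  have hpos : 0 < ∫ t : ℝ, -((z - (t : ℂ))⁻¹).im ∂μ := by
    refine integral_pos_of_ae_pos hint.im.neg (ae_of_all _ fun t => ?_)
    rw [Complex.inv_im]
    have := Complex.normSq_pos.2 (hne t)
    simp only [Complex.sub_im, Complex.ofReal_im, sub_zero, neg_div, neg_neg]
    positivity
  rw [integral_neg] at hpos
  linarith

namespace IsLimitingSpectralLaw

lemma isInversePair (hμ : IsLimitingSpectralLaw γ ν μ) {z : ℂ} (hz : 0 < z.im) :
    IsInversePair γ ν (cauchyTransform μ z) z := by
  have := hμ.isProbabilityMeasure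
  refine ⟨cauchyTransform_im_neg hz, hz, ?_⟩
  have h := congrArg Inv.inv (hμ.fixed_point z hz)
  rw [inv_inv] at h
  rw [inverseMap, h]
  ring

lemma cauchyTransform_eq (hγ : 0 < γ) (hν : IsPopulationLaw ν)
    (hμ : IsLimitingSpectralLaw γ ν μ) {m z : ℂ} (h : IsInversePair γ ν m z) :
    cauchyTransform μ z = m :=
  (hμ.isInversePair h.im_pos).unique hγ hν h

end IsLimitingSpectralLaw

instance nhdsWithin_upperHalf_neBot (x : ℝ) : (𝓝[upperHalf] (x : ℂ)).NeBot := by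
  rw [← mem_closure_iff_nhdsWithin_neBot, upperHalf, Complex.closure_setOfPred_lt_im]
  simp

namespace IsLimitingSpectralLaw

/-- The Cauchy transform is Hölder continuous with exponent `1 / 3` away from the origin. -/
lemma exists_norm_sub_pow_three_le (hγ : 0 < γ) (hν : IsPopulationLaw ν)
    (hμ : IsLimitingSpectralLaw γ ν μ) {x : ℝ} (hx : x ≠ 0) :
    ∃ K > 0, ∀ z ∈ upperHalf ∩ Metric.ball (x : ℂ) (|x| / 2),
      ∀ z' ∈ upperHalf ∩ Metric.ball (x : ℂ) (|x| / 2),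
        ‖cauchyTransform μ z - cauchyTransform μ z'‖ ^ 3 ≤ K * ‖z - z'‖ := by
  have hx' : 0 < |x| / 2 := by positivity
  set M := (γ + 3) / 2 / (|x| / 2) with hMdef
  have hM : 0 < M := by positivity
  have hbd : ∀ z ∈ upperHalf ∩ Metric.ball (x : ℂ) (|x| / 2), ‖cauchyTransform μ z‖ ≤ M := by
    rintro z ⟨hz, hzb⟩
    refine ((hμ.isInversePair hz).norm_le hγ hν).trans ?_
    rw [hMdef]
    gcongr
    rw [Metric.mem_ball, dist_comm, dist_eq_norm] at hzb
    have := norm_sub_norm_le (x : ℂ) z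
    rw [Complex.norm_real, Real.norm_eq_abs] at this
    linarith
  have hk : 0 < γ * ∫ t : ℝ, t ^ 2 / (1 + M * t) ^ 4 ∂ν :=
    mul_pos hγ (integral_sq_div_pos hν hM.le)
  refine ⟨2 * M ^ 2 / (γ * ∫ t : ℝ, t ^ 2 / (1 + M * t) ^ 4 ∂ν), by positivity,
    fun z hz z' hz' => ?_⟩
  rw [div_mul_eq_mul_div, le_div_iff₀ hk]
  exact (hμ.isInversePair hz.1).norm_sub_pow_three_le hγ hν (hμ.isInversePair hz'.1)
    (hbd z hz) (hbd z' hz')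

/-- Away from the origin the Cauchy transform extends continuously to the real axis. -/
lemma tendsto_boundaryCauchy (hγ : 0 < γ) (hν : IsPopulationLaw ν)
    (hμ : IsLimitingSpectralLaw γ ν μ) {x : ℝ} (hx : x ≠ 0) :
    Tendsto (cauchyTransform μ) (𝓝[upperHalf] (x : ℂ)) (𝓝 (boundaryCauchy μ x)) := by
  refine tendsto_nhds_limUnder (cauchy_map_iff_exists_tendsto.1 ?_)
  obtain ⟨K, hK, h⟩ := hμ.exists_norm_sub_pow_three_le hγ hν hx
  refine Metric.cauchy_iff.2 ⟨inferInstance, fun ε hε => ?_⟩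
  have hr : 0 < min (|x| / 2) (ε ^ 3 / (2 * K)) := by positivity
  refine ⟨_, image_mem_map (inter_mem_nhdsWithin upperHalf (Metric.ball_mem_nhds _ hr)), ?_⟩
  rintro _ ⟨z, ⟨hz, hzb⟩, rfl⟩ _ ⟨z', ⟨hz', hzb'⟩, rfl⟩
  have h1 := h z ⟨hz, Metric.ball_subset_ball (min_le_left _ _) hzb⟩
    z' ⟨hz', Metric.ball_subset_ball (min_le_left _ _) hzb'⟩
  have h2 := Metric.ball_subset_ball (min_le_right _ _) hzb
  have h3 := Metric.ball_subset_ball (min_le_right _ _) hzb'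
  have h4 : ‖z - z'‖ < ε ^ 3 / K := by
    rw [← dist_eq_norm]
    calc dist z z' ≤ dist z x + dist z' x := dist_triangle_right _ _ _
      _ < ε ^ 3 / (2 * K) + ε ^ 3 / (2 * K) := add_lt_add h2 h3
      _ = ε ^ 3 / K := by field_simp; norm_num
  rw [lt_div_iff₀' hK] at h4
  rw [dist_eq_norm]
  exact lt_of_pow_lt_pow_left₀ 3 hε.le (h1.trans_lt h4)

lemma continuousOn_boundaryCauchy (hγ : 0 < γ) (hν : IsPopulationLaw ν)
    (hμ : IsLimitingSpectralLaw γ ν μ) : ContinuousOn (boundaryCauchy μ) {0}ᶜ := by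
  have h := continuousOn_extendFrom (A := upperHalf) (f := cauchyTransform μ)
    (B := Complex.ofReal '' {0}ᶜ) ?_ ?_
  · exact h.comp Complex.continuous_ofReal.continuousOn (Set.mapsTo_image _ _)
  · rintro _ ⟨x, -, rfl⟩
    exact mem_closure_iff_nhdsWithin_neBot.2 inferInstance
  · rintro _ ⟨x, hx, rfl⟩
    exact ⟨_, hμ.tendsto_boundaryCauchy hγ hν hx⟩

lemma continuousAt_boundaryCauchy (hγ : 0 < γ) (hν : IsPopulationLaw ν)
    (hμ : IsLimitingSpectralLaw γ ν μ) {x : ℝ} (hx : x ≠ 0) :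
    ContinuousAt (boundaryCauchy μ) x :=
  (hμ.continuousOn_boundaryCauchy hγ hν).continuousAt (isOpen_compl_singleton.mem_nhds hx)

lemma boundaryCauchy_im_nonpos (hγ : 0 < γ) (hν : IsPopulationLaw ν)
    (hμ : IsLimitingSpectralLaw γ ν μ) {x : ℝ} (hx : x ≠ 0) :
    (boundaryCauchy μ x).im ≤ 0 := by
  refine le_of_tendsto ((Complex.continuous_im.tendsto _).comp
    (hμ.tendsto_boundaryCauchy hγ hν hx)) ?_
  filter_upwards [self_mem_nhdsWithin] with z hz using (hμ.isInversePair hz).im_neg.le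

/-- `Im (m z) = γ Im m ∫ t / |1 - m t|² ν(dt)` is negative for `z` in the upper half-plane; when
`Re z < 0` this bounds `Im m` by `Im z`. -/
lemma boundaryCauchy_im_of_neg (hγ : 0 < γ) (hν : IsPopulationLaw ν)
    (hμ : IsLimitingSpectralLaw γ ν μ) {x : ℝ} (hx : x < 0) : (boundaryCauchy μ x).im = 0 := by
  have hlim := hμ.tendsto_boundaryCauchy hγ hν hx.ne
  have hz : Tendsto (fun z : ℂ => z) (𝓝[upperHalf] (x : ℂ)) (𝓝 x) :=
    tendsto_id.mono_left nhdsWithin_le_nhds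
  have h1 : (boundaryCauchy μ x * x).im ≤ 0 := by
    refine le_of_tendsto ((Complex.continuous_im.tendsto _).comp (hlim.mul hz)) ?_
    filter_upwards [self_mem_nhdsWithin] with z hz
    have h := hμ.isInversePair hz
    have him := im_mul_inverseMap (γ := γ) hν h.im_neg.ne
    rw [h.map_eq] at him
    simp only [Function.comp]
    rw [him]
    refine mul_nonpos_of_nonpos_of_nonneg (by nlinarith [h.im_neg]) (integral_nonneg_of_ae ?_)
    filter_upwards [hν.ae_pos] with t ht
    have := Complex.normSq_nonneg (1 - cauchyTransform μ z * (t : ℂ))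
    simp only [Pi.zero_apply]
    positivity
  have h2 := hμ.boundaryCauchy_im_nonpos hγ hν hx.ne
  simp only [Complex.mul_im, Complex.ofReal_im, Complex.ofReal_re, mul_zero, zero_add] at h1
  nlinarith

end IsLimitingSpectralLaw

lemma IsCuspPoint.ne_zero (hγ : 0 < γ) (hν : IsPopulationLaw ν)
    (hμ : IsLimitingSpectralLaw γ ν μ) {a : ℝ} (h : IsCuspPoint μ a) : a ≠ 0 := by
  rintro rfl
  obtain ⟨δ, ⟨hδ, -⟩, hδ0⟩ := (h.2.and self_mem_nhdsWithin).exists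
  refine hδ.ne' ((intervalIntegral.integral_congr (g := fun _ => (0 : ℝ)) fun x hx => ?_).trans
    intervalIntegral.integral_zero)
  rw [Set.uIcc_of_le (by simpa using (Set.mem_Ioi.1 hδ0).le)] at hx
  rcases hx.2.lt_or_eq with hx0 | rfl
  · simp [density, hμ.boundaryCauchy_im_of_neg hγ hν hx0]
  · exact h.1

/-! ### Taylor expansion of the inverse map -/

/-- The moment of order `k` at `x` of the signed measure which puts mass `γ ν(dt)` at
`t / (1 - x t)` and mass `-1` at `-1 / x`. Up to the factor `(k - 1)!` these are the derivatives of
order `k - 1` of `g`. -/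
noncomputable def poleMoment (γ : ℝ) (ν : Measure ℝ) (x : ℝ) (k : ℕ) : ℝ :=
  γ * (∫ t : ℝ, (t / (1 - x * t)) ^ k ∂ν) - (-x⁻¹) ^ k

lemma g_eq_poleMoment (x : ℝ) : g γ ν x = poleMoment γ ν x 1 := by
  simp [g, poleMoment]
  ring

lemma one_sub_mul_ne_zero_of_mem_domainD {c : ℝ} (hc : c ∈ domainD ν) {t : ℝ}
    (ht : t ∈ ν.support) : 1 - c * t ≠ 0 := by
  intro h
  have : t = c⁻¹ := eq_inv_of_mul_eq_one_right (by linarith)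
  exact hc.2 (this ▸ ht)

lemma isOpen_domainD : IsOpen (domainD ν) := by
  have h : ContinuousOn (fun x : ℝ => x⁻¹) {0}ᶜ := continuousOn_inv₀
  exact h.isOpen_inter_preimage isOpen_compl_singleton Measure.isClosed_support.isOpen_compl

lemma integrable_pow (hν : IsPopulationLaw ν) {c : ℝ} (hc : c ∈ domainD ν) (k : ℕ) :
    Integrable (fun t : ℝ => (t / (1 - c * t)) ^ k) ν :=
  hν.integrable_of_continuousOn (ContinuousOn.pow (ContinuousOn.div (by fun_prop) (by fun_prop)
    fun _ ht => one_sub_mul_ne_zero_of_mem_domainD hc ht) k)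

/-- A bound for the support of the signed measure of `poleMoment`. -/
lemma exists_abs_le (hν : IsPopulationLaw ν) {c : ℝ} (hc : c ∈ domainD ν) :
    ∃ T > 0, |-c⁻¹| ≤ T ∧ ∀ t ∈ ν.support, |t / (1 - c * t)| ≤ T := by
  obtain ⟨T, hT⟩ := hν.isCompact_support.exists_bound_of_continuousOn
    (f := fun t : ℝ => t / (1 - c * t)) (ContinuousOn.div (by fun_prop) (by fun_prop)
    fun _ ht => one_sub_mul_ne_zero_of_mem_domainD hc ht)
  exact ⟨max (|-c⁻¹| + 1) T, by positivity, le_max_of_le_left (by linarith),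
    fun t ht => (hT t ht).trans (le_max_right _ _)⟩

lemma continuousOn_sq_div_normSq {m : ℂ} {s : Set ℝ} (hm : ∀ t ∈ s, 1 - m * (t : ℂ) ≠ 0) :
    ContinuousOn (fun t : ℝ => t ^ 2 / Complex.normSq (1 - m * (t : ℂ))) s :=
  ContinuousOn.div (by fun_prop) (Complex.continuous_normSq.comp (by fun_prop)).continuousOn
    fun t ht => by simpa using hm t ht

lemma half_le_norm_one_sub {w : ℂ} {s T : ℝ} (hs : |s| ≤ T) (hw : ‖w‖ * T ≤ 1 / 2) :
    1 / 2 ≤ ‖1 - w * (s : ℂ)‖ := by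
  have h1 := norm_sub_norm_le (1 : ℂ) (w * (s : ℂ))
  have h2 : ‖w‖ * |s| ≤ ‖w‖ * T := by gcongr
  rw [norm_one, norm_mul, Complex.norm_real, Real.norm_eq_abs] at h1
  linarith

lemma norm_pole_sub_le {w : ℂ} {s T : ℝ} (hs : |s| ≤ T) (hw : ‖w‖ * T ≤ 1 / 2) :
    ‖(s : ℂ) / (1 - w * (s : ℂ)) - (s + w * s ^ 2 + w ^ 2 * s ^ 3 + w ^ 3 * s ^ 4)‖
      ≤ 2 * T ^ 5 * ‖w‖ ^ 4 := by
  have h1 := half_le_norm_one_sub hs hw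
  have hT : 0 ≤ T := (abs_nonneg s).trans hs
  have h0 : 1 - w * (s : ℂ) ≠ 0 := norm_pos_iff.1 (by linarith)
  have h2 : (s : ℂ) / (1 - w * (s : ℂ)) - (s + w * s ^ 2 + w ^ 2 * s ^ 3 + w ^ 3 * s ^ 4)
      = w ^ 4 * s ^ 5 / (1 - w * (s : ℂ)) := by
    rw [eq_div_iff h0, sub_mul, div_mul_cancel₀ _ h0]
    ring
  rw [h2, norm_div, norm_mul, norm_pow, norm_pow, Complex.norm_real, Real.norm_eq_abs,
    div_le_iff₀ (by linarith)]
  calc ‖w‖ ^ 4 * |s| ^ 5 ≤ ‖w‖ ^ 4 * T ^ 5 := by gcongr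
    _ = 2 * T ^ 5 * ‖w‖ ^ 4 * (1 / 2) := by ring
    _ ≤ _ := by gcongr

lemma abs_sq_pole_sub_le {w : ℂ} {s T : ℝ} (hs : |s| ≤ T) (hw : ‖w‖ * T ≤ 1 / 2) :
    |s ^ 2 / Complex.normSq (1 - w * (s : ℂ))
        - (s ^ 2 + 2 * w.re * s ^ 3 + (3 * w.re ^ 2 - w.im ^ 2) * s ^ 4)|
      ≤ 40 * T ^ 5 * ‖w‖ ^ 3 := by
  have h1 := half_le_norm_one_sub hs hw
  have hT : 0 ≤ T := (abs_nonneg s).trans hs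
  have hN : 1 / 4 ≤ Complex.normSq (1 - w * (s : ℂ)) := by
    rw [Complex.normSq_eq_norm_sq]
    nlinarith
  have hN' : Complex.normSq (1 - w * (s : ℂ))
      = 1 - 2 * w.re * s + (w.re ^ 2 + w.im ^ 2) * s ^ 2 := by
    simp [Complex.normSq_apply]
    ring
  have hw2 : ‖w‖ ^ 2 = w.re ^ 2 + w.im ^ 2 := by
    rw [← Complex.normSq_eq_norm_sq, Complex.normSq_apply]
    ring
  have hp := Complex.abs_re_le_norm w
  set N := Complex.normSq (1 - w * (s : ℂ))
  set e := 3 * w.re ^ 2 - w.im ^ 2 with he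
  have h2 : s ^ 2 / N - (s ^ 2 + 2 * w.re * s ^ 3 + e * s ^ 4)
      = -(2 * w.re * (‖w‖ ^ 2 - e) * s ^ 5 + ‖w‖ ^ 2 * e * s ^ 6) / N := by
    rw [eq_div_iff (by linarith), sub_mul, div_mul_cancel₀ _ (by linarith), hw2, hN', he]
    ring
  have he1 : |e| ≤ 3 * ‖w‖ ^ 2 := by
    rw [abs_le, hw2, he]
    constructor <;> nlinarith [sq_nonneg w.re, sq_nonneg w.im]
  have he2 : |‖w‖ ^ 2 - e| ≤ 4 * ‖w‖ ^ 2 := by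
    rw [abs_le, hw2, he]
    constructor <;> nlinarith [sq_nonneg w.re, sq_nonneg w.im]
  rw [h2, abs_div, abs_neg, abs_of_pos (by linarith : 0 < N), div_le_iff₀ (by linarith)]
  calc |2 * w.re * (‖w‖ ^ 2 - e) * s ^ 5 + ‖w‖ ^ 2 * e * s ^ 6|
      ≤ |2 * w.re * (‖w‖ ^ 2 - e) * s ^ 5| + |‖w‖ ^ 2 * e * s ^ 6| := abs_add_le _ _
    _ = 2 * |w.re| * |‖w‖ ^ 2 - e| * |s| ^ 5 + ‖w‖ ^ 2 * |e| * |s| ^ 6 := by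
      simp [abs_mul, abs_pow]
    _ ≤ 2 * ‖w‖ * (4 * ‖w‖ ^ 2) * T ^ 5 + ‖w‖ ^ 2 * (3 * ‖w‖ ^ 2) * T ^ 6 := by gcongr
    _ = (8 + 3 * (‖w‖ * T)) * (T ^ 5 * ‖w‖ ^ 3) := by ring
    _ ≤ (8 + 3 * (1 / 2)) * (T ^ 5 * ‖w‖ ^ 3) := by gcongr
    _ ≤ 40 * T ^ 5 * ‖w‖ ^ 3 * (1 / 4) := by nlinarith [show 0 ≤ T ^ 5 * ‖w‖ ^ 3 by positivity]
    _ ≤ _ := by gcongr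

lemma integral_quartic {𝕜 : Type*} [RCLike 𝕜] {f : ℝ → 𝕜}
    (hf : ∀ k : ℕ, Integrable (fun t => f t ^ k) ν) (a₁ a₂ a₃ a₄ : 𝕜) :
    Integrable (fun t => a₁ * f t ^ 1 + a₂ * f t ^ 2 + a₃ * f t ^ 3 + a₄ * f t ^ 4) ν ∧
    ∫ t, a₁ * f t ^ 1 + a₂ * f t ^ 2 + a₃ * f t ^ 3 + a₄ * f t ^ 4 ∂ν
      = a₁ * (∫ t, f t ^ 1 ∂ν) + a₂ * (∫ t, f t ^ 2 ∂ν) + a₃ * (∫ t, f t ^ 3 ∂ν)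
        + a₄ * (∫ t, f t ^ 4 ∂ν) := by
  have h1 := (hf 1).const_mul a₁
  have h2 := (hf 2).const_mul a₂
  have h3 := (hf 3).const_mul a₃
  have h4 := (hf 4).const_mul a₄
  have h12 : Integrable (fun t => a₁ * f t ^ 1 + a₂ * f t ^ 2) ν := h1.add h2
  have h123 : Integrable (fun t => a₁ * f t ^ 1 + a₂ * f t ^ 2 + a₃ * f t ^ 3) ν := h12.add h3
  refine ⟨h123.add h4, ?_⟩
  rw [integral_add h123 h4, integral_add h12 h3, integral_add h1 h2]
  simp only [integral_const_mul]

/-- Third order expansion of `G` at `c`, and second order expansion of its divided difference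
between `m` and `m̄`. -/
lemma exists_expansion (hγ : 0 < γ) (hν : IsPopulationLaw ν) {c : ℝ} (hc : c ∈ domainD ν) :
    ∃ C > 0, ∃ r > 0, ∀ w : ℂ, ‖w‖ ≤ r →
      ‖inverseMap γ ν (c + w) - (g γ ν c + poleMoment γ ν c 2 * w + poleMoment γ ν c 3 * w ^ 2
        + poleMoment γ ν c 4 * w ^ 3)‖ ≤ C * ‖w‖ ^ 4 ∧
      |conjSlope γ ν (c + w) - (poleMoment γ ν c 2 + 2 * poleMoment γ ν c 3 * w.re
        + poleMoment γ ν c 4 * (3 * w.re ^ 2 - w.im ^ 2))| ≤ C * ‖w‖ ^ 3 := by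
  have := hν.isProbabilityMeasure
  obtain ⟨T, hT, hTσ, hTτ⟩ := exists_abs_le hν hc
  refine ⟨40 * (γ + 1) * T ^ 5, by positivity, 1 / (2 * T), by positivity, fun w hw => ?_⟩
  have hw : ‖w‖ * T ≤ 1 / 2 := by
    rw [le_div_iff₀ (by positivity)] at hw
    linarith
  have hc0 : (c : ℂ) ≠ 0 := by exact_mod_cast hc.1
  have hne : ∀ t ∈ ν.support, (1 - (c + w) * (t : ℂ))
      = (1 - c * t) * (1 - w * ((t / (1 - c * t) : ℝ) : ℂ)) := by
    intro t ht
    have h : (1 : ℂ) - c * t ≠ 0 := by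
      exact_mod_cast one_sub_mul_ne_zero_of_mem_domainD hc ht
    push_cast
    field_simp
    ring
  have hne0 : ∀ t ∈ ν.support, 1 - (c + w) * (t : ℂ) ≠ 0 := by
    intro t ht
    rw [hne t ht]
    refine mul_ne_zero (by exact_mod_cast one_sub_mul_ne_zero_of_mem_domainD hc ht)
      (norm_pos_iff.1 ?_)
    linarith [half_le_norm_one_sub (hTτ t ht) hw]
  have hσ : c + w = c * (1 - w * ((-c⁻¹ : ℝ) : ℂ)) := by
    push_cast
    field_simp
    ring
  have hi := integrable_pow hν hc
  have hic : ∀ k, Integrable (fun t : ℝ => ((t / (1 - c * t) : ℝ) : ℂ) ^ k) ν := fun k => by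
    simpa using (hi k).ofReal (𝕜 := ℂ)
  have hmom : ∀ k, (poleMoment γ ν c k : ℂ)
      = γ * (∫ t : ℝ, ((t / (1 - c * t) : ℝ) : ℂ) ^ k ∂ν) - ((-c⁻¹ : ℝ) : ℂ) ^ k := by
    intro k
    rw [poleMoment]
    push_cast [← integral_complex_ofReal]
    rfl
  constructor
  · obtain ⟨hq, hqe⟩ := integral_quartic hic 1 w (w ^ 2) (w ^ 3)
    have hf := hν.integrable_of_continuousOn (continuousOn_div_one_sub hne0)
    have he : ‖∫ t : ℝ, ((t : ℂ) / (1 - (c + w) * (t : ℂ))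
          - (1 * ((t / (1 - c * t) : ℝ) : ℂ) ^ 1 + w * ((t / (1 - c * t) : ℝ) : ℂ) ^ 2
            + w ^ 2 * ((t / (1 - c * t) : ℝ) : ℂ) ^ 3
            + w ^ 3 * ((t / (1 - c * t) : ℝ) : ℂ) ^ 4)) ∂ν‖ ≤ 2 * T ^ 5 * ‖w‖ ^ 4 := by
      refine (norm_integral_le_of_norm_le_const (C := 2 * T ^ 5 * ‖w‖ ^ 4) ?_).trans (by simp)
      filter_upwards [IsPopulationLaw.ae_mem_support] with t ht
      have h := norm_pole_sub_le (hTτ t ht) hw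
      have h1 : (t : ℂ) / (1 - (c + w) * (t : ℂ)) = ((t / (1 - c * t) : ℝ) : ℂ)
          / (1 - w * ((t / (1 - c * t) : ℝ) : ℂ)) := by
        rw [hne t ht]
        push_cast
        rw [div_div]
      rw [h1]
      simpa only [one_mul, pow_one] using h
    rw [integral_sub hf hq, hqe] at he
    have he' := norm_pole_sub_le hTσ hw
    have hinv : (c + w)⁻¹ = -(((-c⁻¹ : ℝ) : ℂ) / (1 - w * ((-c⁻¹ : ℝ) : ℂ))) := by
      rw [hσ, mul_inv]
      push_cast
      ring
    rw [g_eq_poleMoment, hmom, hmom, hmom, hmom, inverseMap, hinv]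
    set σ : ℂ := ((-c⁻¹ : ℝ) : ℂ)
    set E := (∫ t : ℝ, (t : ℂ) / (1 - (c + w) * (t : ℂ)) ∂ν)
      - (1 * (∫ t : ℝ, ((t / (1 - c * t) : ℝ) : ℂ) ^ 1 ∂ν)
        + w * (∫ t : ℝ, ((t / (1 - c * t) : ℝ) : ℂ) ^ 2 ∂ν)
        + w ^ 2 * (∫ t : ℝ, ((t / (1 - c * t) : ℝ) : ℂ) ^ 3 ∂ν)
        + w ^ 3 * (∫ t : ℝ, ((t / (1 - c * t) : ℝ) : ℂ) ^ 4 ∂ν)) with hE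
    set E' := σ / (1 - w * σ) - (σ + w * σ ^ 2 + w ^ 2 * σ ^ 3 + w ^ 3 * σ ^ 4) with hE'
    calc _ = ‖γ * E - E'‖ := by
          congr 1
          rw [hE, hE']
          ring
      _ ≤ ‖γ * E‖ + ‖E'‖ := norm_sub_le _ _
      _ = γ * ‖E‖ + ‖E'‖ := by
          rw [norm_mul, Complex.norm_real, Real.norm_of_nonneg hγ.le]
      _ ≤ γ * (2 * T ^ 5 * ‖w‖ ^ 4) + 2 * T ^ 5 * ‖w‖ ^ 4 := by gcongr
      _ = 2 * (γ + 1) * T ^ 5 * ‖w‖ ^ 4 := by ring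
      _ ≤ 40 * (γ + 1) * T ^ 5 * ‖w‖ ^ 4 := by gcongr; norm_num
  · obtain ⟨hq, hqe⟩ := integral_quartic hi 0 1 (2 * w.re) (3 * w.re ^ 2 - w.im ^ 2)
    have hf := hν.integrable_of_continuousOn (continuousOn_sq_div_normSq hne0)
    have he : ‖∫ t : ℝ, (t ^ 2 / Complex.normSq (1 - (c + w) * (t : ℂ))
          - (0 * (t / (1 - c * t)) ^ 1 + 1 * (t / (1 - c * t)) ^ 2
            + 2 * w.re * (t / (1 - c * t)) ^ 3
            + (3 * w.re ^ 2 - w.im ^ 2) * (t / (1 - c * t)) ^ 4)) ∂ν‖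
        ≤ 40 * T ^ 5 * ‖w‖ ^ 3 := by
      refine (norm_integral_le_of_norm_le_const (C := 40 * T ^ 5 * ‖w‖ ^ 3) ?_).trans (by simp)
      filter_upwards [IsPopulationLaw.ae_mem_support] with t ht
      have h := abs_sq_pole_sub_le (hTτ t ht) hw
      have h1 : t ^ 2 / Complex.normSq (1 - (c + w) * (t : ℂ)) = (t / (1 - c * t)) ^ 2
          / Complex.normSq (1 - w * ((t / (1 - c * t) : ℝ) : ℂ)) := by
        have h2 : (1 : ℂ) - c * t = ((1 - c * t : ℝ) : ℂ) := by push_cast; rfl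
        rw [hne t ht, map_mul, h2, Complex.normSq_ofReal, div_pow, div_div, sq (1 - c * t)]
      rw [h1]
      simpa only [zero_mul, zero_add, one_mul, Real.norm_eq_abs] using h
    rw [integral_sub hf hq, hqe, Real.norm_eq_abs] at he
    have he' := abs_sq_pole_sub_le hTσ hw
    have hinv : (Complex.normSq (c + w))⁻¹
        = (-c⁻¹) ^ 2 / Complex.normSq (1 - w * ((-c⁻¹ : ℝ) : ℂ)) := by
      rw [hσ, map_mul, Complex.normSq_ofReal, mul_inv]
      ring
    rw [conjSlope, poleMoment, poleMoment, poleMoment, hinv]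
    set σ : ℝ := -c⁻¹
    set E := (∫ t : ℝ, t ^ 2 / Complex.normSq (1 - (c + w) * (t : ℂ)) ∂ν)
      - (0 * (∫ t : ℝ, (t / (1 - c * t)) ^ 1 ∂ν)
        + 1 * (∫ t : ℝ, (t / (1 - c * t)) ^ 2 ∂ν)
        + 2 * w.re * (∫ t : ℝ, (t / (1 - c * t)) ^ 3 ∂ν)
        + (3 * w.re ^ 2 - w.im ^ 2) * (∫ t : ℝ, (t / (1 - c * t)) ^ 4 ∂ν)) with hE
    set E' := σ ^ 2 / Complex.normSq (1 - w * (σ : ℂ))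
      - (σ ^ 2 + 2 * w.re * σ ^ 3 + (3 * w.re ^ 2 - w.im ^ 2) * σ ^ 4) with hE'
    calc _ = |γ * E - E'| := by
          congr 1
          rw [hE, hE']
          ring
      _ ≤ |γ * E| + |E'| := abs_sub _ _
      _ = γ * |E| + |E'| := by rw [abs_mul, abs_of_pos hγ]
      _ ≤ γ * (40 * T ^ 5 * ‖w‖ ^ 3) + 40 * T ^ 5 * ‖w‖ ^ 3 := by gcongr
      _ = 40 * (γ + 1) * T ^ 5 * ‖w‖ ^ 3 := by ring

/-! ### Derivatives of `g` -/

lemma hasDerivAt_integral_pow (hν : IsPopulationLaw ν) {c : ℝ} (hc : c ∈ domainD ν) (k : ℕ) :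
    HasDerivAt (fun x => ∫ t : ℝ, (t / (1 - x * t)) ^ (k + 1) ∂ν)
      ((k + 1) * ∫ t : ℝ, (t / (1 - c * t)) ^ (k + 2) ∂ν) c := by
  have := hν.isProbabilityMeasure
  obtain ⟨T, hT, -, hTτ⟩ := exists_abs_le hν hc
  rw [← integral_const_mul]
  have hmeas : ∀ (x : ℝ) (j : ℕ), AEStronglyMeasurable (fun t : ℝ => (t / (1 - x * t)) ^ j) ν :=
    fun x j => Measurable.aestronglyMeasurable (by fun_prop)
  -- On the ball of radius `1 / (2 T)` the poles `t / (1 - x t)` at most double in size.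
  have key : ∀ t ∈ ν.support, ∀ x ∈ Metric.ball c (1 / (2 * T)),
      1 - x * t ≠ 0 ∧ |t / (1 - x * t)| ≤ 2 * T := by
    intro t ht x hx
    have h0 := one_sub_mul_ne_zero_of_mem_domainD hc ht
    have hx' : ‖((x - c : ℝ) : ℂ)‖ * T ≤ 1 / 2 := by
      rw [Metric.mem_ball, Real.dist_eq, lt_div_iff₀ (by positivity)] at hx
      rw [Complex.norm_real, Real.norm_eq_abs]
      linarith
    have h1 := half_le_norm_one_sub (hTτ t ht) hx'
    have h2 : (1 : ℂ) - ((x - c : ℝ) : ℂ) * ((t / (1 - c * t) : ℝ) : ℂ)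
        = ((1 - (x - c) * (t / (1 - c * t)) : ℝ) : ℂ) := by push_cast; rfl
    rw [h2, Complex.norm_real, Real.norm_eq_abs] at h1
    have h3 : 1 - x * t = (1 - c * t) * (1 - (x - c) * (t / (1 - c * t))) := by
      linear_combination (x - c) * mul_div_cancel₀ t h0
    have h4 : 1 - (x - c) * (t / (1 - c * t)) ≠ 0 := abs_pos.1 (by linarith)
    refine ⟨h3 ▸ mul_ne_zero h0 h4, ?_⟩
    rw [h3, ← div_div, abs_div, div_le_iff₀ (by linarith)]
    nlinarith [hTτ t ht]
  refine (hasDerivAt_integral_of_dominated_loc_of_deriv_le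
    (F' := fun x t => ((k : ℝ) + 1) * (t / (1 - x * t)) ^ (k + 2))
    (bound := fun _ => ((k : ℝ) + 1) * (2 * T) ^ (k + 2))
    (Metric.ball_mem_nhds c (by positivity : 0 < 1 / (2 * T)))
    (Eventually.of_forall fun x => hmeas x (k + 1)) (integrable_pow hν hc (k + 1))
    ((hmeas c (k + 2)).const_mul _) ?_ (integrable_const _) ?_).2
  · filter_upwards [IsPopulationLaw.ae_mem_support] with t ht x hx
    rw [norm_mul, norm_pow, Real.norm_eq_abs, Real.norm_eq_abs,
      abs_of_nonneg (by positivity : (0 : ℝ) ≤ k + 1)]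
    gcongr
    exact (key t ht x hx).2
  · filter_upwards [IsPopulationLaw.ae_mem_support] with t ht x hx
    have h0 := (key t ht x hx).1
    have h1 : HasDerivAt (fun x : ℝ => 1 - x * t) (-t) x := by
      simpa using ((hasDerivAt_id x).mul_const t).const_sub 1
    have h2 := ((h1.fun_inv h0).const_mul t).fun_pow (k + 1)
    simp only [← div_eq_mul_inv] at h2
    refine h2.congr_deriv ?_
    rw [Nat.add_sub_cancel, neg_neg]
    simp only [div_eq_mul_inv, ← inv_pow]
    push_cast
    ring

lemma hasDerivAt_poleMoment (hν : IsPopulationLaw ν) {c : ℝ} (hc : c ∈ domainD ν) (k : ℕ) :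
    HasDerivAt (fun x => poleMoment γ ν x (k + 1)) ((k + 1) * poleMoment γ ν c (k + 2)) c := by
  have h1 := (hasDerivAt_integral_pow hν hc k).const_mul γ
  have h2 := (hasDerivAt_inv hc.1).fun_neg.fun_pow (k + 1)
  refine (h1.fun_sub h2).congr_deriv ?_
  rw [Nat.add_sub_cancel, poleMoment]
  push_cast
  ring

lemma iteratedDeriv_g (hν : IsPopulationLaw ν) (k : ℕ) {c : ℝ} (hc : c ∈ domainD ν) :
    iteratedDeriv k (g γ ν) c = k.factorial * poleMoment γ ν c (k + 1) := by
  induction k generalizing c with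
  | zero => simp [g_eq_poleMoment]
  | succ k ih =>
    rw [iteratedDeriv_succ]
    have h : iteratedDeriv k (g γ ν) =ᶠ[𝓝 c] fun x => k.factorial * poleMoment γ ν x (k + 1) := by
      filter_upwards [isOpen_domainD.mem_nhds hc] with x hx using ih hx
    rw [h.deriv_eq, ((hasDerivAt_poleMoment hν hc k).const_mul _).deriv, Nat.factorial_succ]
    push_cast
    ring

/-- If the second and third moments of the signed measure of `poleMoment` vanish, then the fourth
one is `γ ∫ τ² (τ - σ)² ν(dt)` with `τ = t / (1 - c t)` and `σ = -1 / c`. -/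
lemma poleMoment_four_pos (hγ : 0 < γ) (hν : IsPopulationLaw ν) {c : ℝ} (hc : c ∈ domainD ν)
    (h2 : poleMoment γ ν c 2 = 0) (h3 : poleMoment γ ν c 3 = 0) : 0 < poleMoment γ ν c 4 := by
  obtain ⟨-, hqe⟩ := integral_quartic (integrable_pow hν hc) 0 ((-c⁻¹) ^ 2) (-2 * (-c⁻¹)) 1
  have hpos : 0 < ∫ t : ℝ, (t / (1 - c * t)) ^ 2 * (t / (1 - c * t) - (-c⁻¹)) ^ 2 ∂ν := by
    have hcont : ContinuousOn (fun t : ℝ => t / (1 - c * t)) ν.support :=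
      ContinuousOn.div (by fun_prop) (by fun_prop)
        fun _ ht => one_sub_mul_ne_zero_of_mem_domainD hc ht
    refine hν.integral_pos_of_pos ((hcont.pow 2).mul ((hcont.sub continuousOn_const).pow 2)) ?_
    intro t ht
    have h0 := one_sub_mul_ne_zero_of_mem_domainD hc ht
    have ht0 : t ≠ 0 := (hν.support_subset ht).ne'
    have hc0 := hc.1
    have h1 : t / (1 - c * t) - (-c⁻¹) = 1 / (c * (1 - c * t)) := by
      rw [eq_div_iff (mul_ne_zero hc0 h0)]
      linear_combination c * div_mul_cancel₀ t h0 + (1 - c * t) * inv_mul_cancel₀ hc0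
    rw [h1]
    positivity
  have heq : ∫ t : ℝ, (t / (1 - c * t)) ^ 2 * (t / (1 - c * t) - (-c⁻¹)) ^ 2 ∂ν
      = ∫ t : ℝ, 0 * (t / (1 - c * t)) ^ 1 + (-c⁻¹) ^ 2 * (t / (1 - c * t)) ^ 2
        + (-2 * (-c⁻¹)) * (t / (1 - c * t)) ^ 3 + 1 * (t / (1 - c * t)) ^ 4 ∂ν :=
    integral_congr_ae (ae_of_all _ fun t => by ring)
  rw [heq, hqe] at hpos
  have hpos' := mul_pos hγ hpos
  rw [poleMoment] at h2 h3 ⊢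
  refine hpos'.trans_eq ?_
  linear_combination (-c⁻¹) ^ 2 * h2 + (-2 * (-c⁻¹)) * h3

/-- At a critical point, `g(c) = (x g(x))'(c) = γ ∫ t / (1 - c t)² ν(dt)`. -/
lemma g_pos_of_poleMoment_two (hγ : 0 < γ) (hν : IsPopulationLaw ν) {c : ℝ} (hc : c ∈ domainD ν)
    (h2 : poleMoment γ ν c 2 = 0) : 0 < g γ ν c := by
  obtain ⟨-, hqe⟩ := integral_quartic (integrable_pow hν hc) 1 c 0 0
  have hpos : 0 < ∫ t : ℝ, t / (1 - c * t) ^ 2 ∂ν := by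
    refine hν.integral_pos_of_pos (ContinuousOn.div (by fun_prop) (by fun_prop)
        fun _ ht => pow_ne_zero 2 (one_sub_mul_ne_zero_of_mem_domainD hc ht)) ?_
    intro t ht
    have h0 := one_sub_mul_ne_zero_of_mem_domainD hc ht
    have ht0 : 0 < t := hν.support_subset ht
    positivity
  have heq : ∫ t : ℝ, t / (1 - c * t) ^ 2 ∂ν
      = ∫ t : ℝ, 1 * (t / (1 - c * t)) ^ 1 + c * (t / (1 - c * t)) ^ 2
        + 0 * (t / (1 - c * t)) ^ 3 + 0 * (t / (1 - c * t)) ^ 4 ∂ν := by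
    refine integral_congr_ae ?_
    filter_upwards [IsPopulationLaw.ae_mem_support] with t ht
    have h0 := one_sub_mul_ne_zero_of_mem_domainD hc ht
    rw [div_eq_iff (pow_ne_zero 2 h0)]
    linear_combination -((1 - c * t) + c * (t / (1 - c * t) * (1 - c * t) + t))
      * div_mul_cancel₀ t h0
  rw [heq, hqe] at hpos
  have hpos' := mul_pos hγ hpos
  rw [g_eq_poleMoment]
  rw [poleMoment] at h2 ⊢
  have hc0 := hc.1
  have hcc : c * (-c⁻¹) ^ 2 = c⁻¹ := by field_simp
  refine hpos'.trans_eq ?_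
  linear_combination c * h2 + hcc

/-! ### Local analysis of the boundary values -/

/-- Boundary values `c + w(x)`, for real `x` near `a`, of the inverse of a map whose Taylor
expansion at `c` is `a + A₁ w + A₂ w² + A₃ w³ + O(w⁴)`. The conditions on
`A₁ + 2 A₂ Re w + A₃ (3 (Re w)² - (Im w)²)`, the main part of the divided difference between `w` and
`w̄`, express that this divided difference is nonpositive, and that it vanishes where `w(x)` is not
real. -/
structure IsBoundaryInverse (a A₁ A₂ A₃ C : ℝ) (w : ℝ → ℂ) : Prop where
  tendsto : Tendsto w (𝓝 a) (𝓝 0)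
  slope_le : ∀ᶠ x in 𝓝 a,
    A₁ + 2 * A₂ * (w x).re + A₃ * (3 * (w x).re ^ 2 - (w x).im ^ 2) ≤ C * ‖w x‖ ^ 3
  abs_slope_le : ∀ᶠ x in 𝓝 a, (w x).im ≠ 0 →
    |A₁ + 2 * A₂ * (w x).re + A₃ * (3 * (w x).re ^ 2 - (w x).im ^ 2)| ≤ C * ‖w x‖ ^ 3
  norm_sub_le : ∀ᶠ x : ℝ in 𝓝 a,
    ‖(x : ℂ) - (a + A₁ * w x + A₂ * w x ^ 2 + A₃ * w x ^ 3)‖ ≤ C * ‖w x‖ ^ 4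

lemma IsLimitingSpectralLaw.exists_isBoundaryInverse (hγ : 0 < γ) (hν : IsPopulationLaw ν)
    (hμ : IsLimitingSpectralLaw γ ν μ) {a c : ℝ} (ha : a ≠ 0) (hb : boundaryCauchy μ a = c)
    (hc : c ∈ domainD ν) :
    g γ ν c = a ∧ ∃ C > 0, IsBoundaryInverse a (poleMoment γ ν c 2) (poleMoment γ ν c 3)
      (poleMoment γ ν c 4) C (fun x => boundaryCauchy μ x - c) := by
  obtain ⟨C, hC, r, hr, hexp⟩ := exists_expansion hγ hν hc
  have hw : Tendsto (fun x => boundaryCauchy μ x - c) (𝓝 a) (𝓝 0) := by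
    have h := (hμ.continuousAt_boundaryCauchy hγ hν ha).tendsto.sub_const (c : ℂ)
    rwa [hb, sub_self] at h
  have hnear : ∀ᶠ x in 𝓝 a, x ≠ 0 ∧ ‖boundaryCauchy μ x - c‖ < r :=
    (eventually_ne_nhds ha).and (hw.norm.eventually_lt_const (by simpa using hr))
  -- The estimates hold in the upper half-plane and pass to the limit on the real axis.
  have key : ∀ x : ℝ, x ≠ 0 ∧ ‖boundaryCauchy μ x - c‖ < r →
      Tendsto (fun z => (z, cauchyTransform μ z - c)) (𝓝[upperHalf] (x : ℂ))
        (𝓝 ((x : ℂ), boundaryCauchy μ x - c)) ∧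
      ∀ᶠ z in 𝓝[upperHalf] (x : ℂ), 0 < z.im ∧ (cauchyTransform μ z).im ≠ 0 ∧
        conjSlope γ ν (cauchyTransform μ z) < 0 ∧
        z.im = (cauchyTransform μ z).im * conjSlope γ ν (cauchyTransform μ z) ∧
        ‖z - (g γ ν c + poleMoment γ ν c 2 * (cauchyTransform μ z - c)
          + poleMoment γ ν c 3 * (cauchyTransform μ z - c) ^ 2
          + poleMoment γ ν c 4 * (cauchyTransform μ z - c) ^ 3)‖
            ≤ C * ‖cauchyTransform μ z - c‖ ^ 4 ∧
        |conjSlope γ ν (cauchyTransform μ z)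
          - (poleMoment γ ν c 2 + 2 * poleMoment γ ν c 3 * (cauchyTransform μ z - c).re
            + poleMoment γ ν c 4 * (3 * (cauchyTransform μ z - c).re ^ 2
              - (cauchyTransform μ z - c).im ^ 2))| ≤ C * ‖cauchyTransform μ z - c‖ ^ 3 := by
    rintro x ⟨hx, hxr⟩
    have hlim := (hμ.tendsto_boundaryCauchy hγ hν hx).sub_const (c : ℂ)
    refine ⟨(tendsto_id.mono_left nhdsWithin_le_nhds).prodMk_nhds hlim, ?_⟩
    filter_upwards [self_mem_nhdsWithin, hlim.norm.eventually_lt_const hxr] with z hz hzr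
    have h := hμ.isInversePair hz
    have h1 := inverseMap_im (γ := γ) hν h.im_neg.ne
    rw [h.map_eq] at h1
    have h2 := hexp (cauchyTransform μ z - c) hzr.le
    rw [add_sub_cancel, h.map_eq] at h2
    exact ⟨hz, h.im_neg.ne, h.conjSlope_neg hν, h1, h2.1, h2.2⟩
  have hsub : ∀ᶠ x : ℝ in 𝓝 a,
      ‖(x : ℂ) - (g γ ν c + poleMoment γ ν c 2 * (boundaryCauchy μ x - c)
        + poleMoment γ ν c 3 * (boundaryCauchy μ x - c) ^ 2
        + poleMoment γ ν c 4 * (boundaryCauchy μ x - c) ^ 3)‖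
        ≤ C * ‖boundaryCauchy μ x - c‖ ^ 4 := by
    filter_upwards [hnear] with x hx
    obtain ⟨hlim, hev⟩ := key x hx
    refine le_of_tendsto_of_tendsto
      ((Continuous.tendsto (f := fun p : ℂ × ℂ => ‖p.1 - (g γ ν c + poleMoment γ ν c 2 * p.2
        + poleMoment γ ν c 3 * p.2 ^ 2 + poleMoment γ ν c 4 * p.2 ^ 3)‖)
        (by fun_prop) _).comp hlim)
      ((Continuous.tendsto (f := fun p : ℂ × ℂ => C * ‖p.2‖ ^ 4) (by fun_prop) _).comp hlim) ?_
    filter_upwards [hev] with z hz using hz.2.2.2.2.1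
  have hga : g γ ν c = a := by
    have h := hsub.self_of_nhds
    rw [hb] at h
    simp only [sub_self] at h
    norm_num at h
    rw [sub_eq_zero] at h
    exact_mod_cast h.symm
  refine ⟨hga, C, hC, hw, ?_, ?_, by rwa [hga] at hsub⟩
  · filter_upwards [hnear] with x hx
    obtain ⟨hlim, hev⟩ := key x hx
    refine le_of_tendsto_of_tendsto
      ((Continuous.tendsto (f := fun p : ℂ × ℂ => poleMoment γ ν c 2
        + 2 * poleMoment γ ν c 3 * p.2.re + poleMoment γ ν c 4 * (3 * p.2.re ^ 2 - p.2.im ^ 2))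
        (by fun_prop) _).comp hlim)
      ((Continuous.tendsto (f := fun p : ℂ × ℂ => C * ‖p.2‖ ^ 3) (by fun_prop) _).comp hlim) ?_
    filter_upwards [hev] with z hz
    have := (abs_le.1 hz.2.2.2.2.2).1
    simp only [Function.comp]
    linarith [hz.2.2.1]
  · filter_upwards [hnear] with x hx him
    obtain ⟨hlim, hev⟩ := key x hx
    have h0 : Tendsto (fun z => z.im / (cauchyTransform μ z - c).im) (𝓝[upperHalf] (x : ℂ))
        (𝓝 0) := by
      have h : Tendsto (fun z => z.im) (𝓝[upperHalf] (x : ℂ)) (𝓝 (x : ℂ).im) :=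
        ((Complex.continuous_im.comp continuous_fst).tendsto _).comp hlim
      have h' : Tendsto (fun z => (cauchyTransform μ z - c).im) (𝓝[upperHalf] (x : ℂ))
          (𝓝 (boundaryCauchy μ x - c).im) :=
        ((Complex.continuous_im.comp continuous_snd).tendsto _).comp hlim
      rw [← zero_div (boundaryCauchy μ x - c).im]
      exact h.div h' him
    have hP := (Continuous.tendsto (f := fun p : ℂ × ℂ => poleMoment γ ν c 2
        + 2 * poleMoment γ ν c 3 * p.2.re + poleMoment γ ν c 4 * (3 * p.2.re ^ 2 - p.2.im ^ 2))
        (by fun_prop) _).comp hlim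
    have hlhs := (h0.sub hP).abs
    rw [zero_sub, abs_neg] at hlhs
    refine le_of_tendsto_of_tendsto hlhs
      ((Continuous.tendsto (f := fun p : ℂ × ℂ => C * ‖p.2‖ ^ 3) (by fun_prop) _).comp hlim) ?_
    filter_upwards [hev] with z hz
    have h1 : z.im / (cauchyTransform μ z - c).im = conjSlope γ ν (cauchyTransform μ z) := by
      rw [Complex.sub_im, Complex.ofReal_im, sub_zero, div_eq_iff hz.2.1, mul_comm]
      exact hz.2.2.2.1
    simp only [Function.comp]
    rw [h1]
    exact hz.2.2.2.2.2

lemma norm_sq_eq_re_sq_add_im_sq (v : ℂ) : ‖v‖ ^ 2 = v.re ^ 2 + v.im ^ 2 := by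
  rw [← Complex.normSq_eq_norm_sq, Complex.normSq_apply]
  ring

namespace IsBoundaryInverse

variable {a A₁ A₂ A₃ C : ℝ} {w : ℝ → ℂ}

lemma coeff_one_eq_zero (h : IsBoundaryInverse a A₁ A₂ A₃ C w)
    (hfreq : ∃ᶠ x in 𝓝 a, (w x).im ≠ 0) : A₁ = 0 := by
  by_contra hA
  have hlim := (Continuous.tendsto (f := fun v : ℂ => |A₁ + 2 * A₂ * v.re
    + A₃ * (3 * v.re ^ 2 - v.im ^ 2)| - C * ‖v‖ ^ 3) (by fun_prop) 0).comp h.tendsto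
  have hpos := hlim.eventually_const_lt (u := 0) (by simpa using hA)
  obtain ⟨x, hx, h1, h2⟩ := (hfreq.and_eventually (hpos.and h.abs_slope_le)).exists
  have := h2 hx
  simp only [Function.comp] at h1
  linarith

/-- If `A₁ = 0` and `A₂ ≠ 0`, then nonreal values occur on one side of `a` only: the vanishing of
the divided difference makes `w` almost imaginary, and `x - a` has the sign of `A₂ w²`. -/
lemma coeff_two_mul_neg (h : IsBoundaryInverse a 0 A₂ A₃ C w) (hC : 0 < C) (hA : A₂ ≠ 0) :
    ∀ᶠ x in 𝓝 a, (w x).im ≠ 0 → A₂ * (x - a) < 0 := by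
  -- With `s = ‖w‖ ≤ 1`, the constant `K` bounds both `|2 A₂ p| / s ^ 2` and
  -- `|x - a - A₂ (p ^ 2 - q ^ 2)| / s ^ 3`.
  set K := C + 3 * |A₃| with hK
  have hK0 : 0 ≤ K := by positivity
  have hlim := (Continuous.tendsto (f := fun v : ℂ => -A₂ ^ 2 + K ^ 2 * ‖v‖ ^ 2 / 2
    + |A₂| * K * ‖v‖) (by fun_prop) 0).comp h.tendsto
  have hneg := hlim.eventually_lt_const (u := 0) (by simpa using sq_pos_of_ne_zero hA)
  have hs1 := h.tendsto.norm.eventually_lt_const (u := 1) (by simp)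
  filter_upwards [hneg, hs1, h.abs_slope_le, h.norm_sub_le] with x hneg hs1 habs hsub him
  have habs := habs him
  simp only [Function.comp] at hneg
  have hs : 0 < ‖w x‖ := norm_pos_iff.2 fun h0 => him (by simp [h0])
  have hre := (Complex.abs_re_le_norm ((x : ℂ) - (a + (0 : ℝ) * w x + A₂ * w x ^ 2
    + A₃ * w x ^ 3))).trans hsub
  have hw2 := norm_sq_eq_re_sq_add_im_sq (w x)
  set s := ‖w x‖
  set p := (w x).re
  set q := (w x).im
  have hp : |2 * A₂ * p| ≤ K * s ^ 2 := by
    have h1 : |3 * p ^ 2 - q ^ 2| ≤ 3 * s ^ 2 := by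
      rw [abs_le, hw2]
      constructor <;> nlinarith [sq_nonneg p, sq_nonneg q]
    calc |2 * A₂ * p| = |(0 + 2 * A₂ * p + A₃ * (3 * p ^ 2 - q ^ 2))
          - A₃ * (3 * p ^ 2 - q ^ 2)| := by congr 1; ring
      _ ≤ |0 + 2 * A₂ * p + A₃ * (3 * p ^ 2 - q ^ 2)| + |A₃ * (3 * p ^ 2 - q ^ 2)| := abs_sub _ _
      _ ≤ C * s ^ 3 + |A₃| * (3 * s ^ 2) := by
        rw [abs_mul]
        gcongr
      _ ≤ C * s ^ 2 + |A₃| * (3 * s ^ 2) := by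
        gcongr 2
        exact pow_le_pow_of_le_one hs.le hs1.le (by norm_num)
      _ = K * s ^ 2 := by rw [hK]; ring
  have hx : |x - a - A₂ * (p ^ 2 - q ^ 2)| ≤ K * s ^ 3 := by
    have e : ((x : ℂ) - (a + (0 : ℝ) * w x + A₂ * w x ^ 2 + A₃ * w x ^ 3)).re
        = x - a - A₂ * (p ^ 2 - q ^ 2) - A₃ * (w x ^ 3).re := by
      simp [pow_two, p, q]
      ring
    have h3 : |(w x ^ 3).re| ≤ s ^ 3 := (Complex.abs_re_le_norm _).trans (norm_pow _ _).le
    rw [e] at hre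
    calc |x - a - A₂ * (p ^ 2 - q ^ 2)|
        = |(x - a - A₂ * (p ^ 2 - q ^ 2) - A₃ * (w x ^ 3).re) + A₃ * (w x ^ 3).re| := by
          congr 1; ring
      _ ≤ _ := abs_add_le _ _
      _ ≤ C * s ^ 4 + |A₃| * s ^ 3 := by
        rw [abs_mul]
        gcongr
      _ ≤ C * s ^ 3 + 3 * |A₃| * s ^ 3 := by
        gcongr ?_ + ?_ * s ^ 3
        · gcongr 1
          exact pow_le_pow_of_le_one hs.le hs1.le (by norm_num)
        · linarith [abs_nonneg A₃]
      _ = K * s ^ 3 := by rw [hK]; ring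
  have hp2 : 4 * A₂ ^ 2 * p ^ 2 ≤ K ^ 2 * s ^ 4 := by
    have := pow_le_pow_left₀ (abs_nonneg _) hp 2
    rw [sq_abs] at this
    linarith
  have hx2 : A₂ * (x - a) - A₂ ^ 2 * (p ^ 2 - q ^ 2) ≤ |A₂| * (K * s ^ 3) := by
    calc _ = A₂ * (x - a - A₂ * (p ^ 2 - q ^ 2)) := by ring
      _ ≤ |A₂| * |x - a - A₂ * (p ^ 2 - q ^ 2)| := by
        rw [← abs_mul]
        exact le_abs_self _
      _ ≤ _ := by gcongr
  have hfin : s ^ 2 * (-A₂ ^ 2 + K ^ 2 * s ^ 2 / 2 + |A₂| * K * s) < 0 :=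
    mul_neg_of_pos_of_neg (by positivity) hneg
  have hq : q ^ 2 = s ^ 2 - p ^ 2 := by linarith
  rw [hq] at hx2
  linarith

lemma coeff_two_eq_zero (h : IsBoundaryInverse a 0 A₂ A₃ C w) (hC : 0 < C)
    (hright : ∃ᶠ x in 𝓝[>] a, (w x).im ≠ 0) (hleft : ∃ᶠ x in 𝓝[<] a, (w x).im ≠ 0) : A₂ = 0 := by
  by_contra hA
  have hneg := h.coeff_two_mul_neg hC hA
  obtain ⟨x, ⟨hx, hx'⟩, hxa⟩ := ((hright.and_eventually (hneg.filter_mono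
    nhdsWithin_le_nhds)).and_eventually self_mem_nhdsWithin).exists
  obtain ⟨y, ⟨hy, hy'⟩, hya⟩ := ((hleft.and_eventually (hneg.filter_mono
    nhdsWithin_le_nhds)).and_eventually self_mem_nhdsWithin).exists
  have h1 := hx' hx
  have h2 := hy' hy
  have h3 : 0 < x - a := sub_pos.2 hxa
  have h4 : y - a < 0 := sub_neg.2 hya
  rcases lt_or_gt_of_ne hA with hA | hA <;> nlinarith

/-- If `A₁ = A₂ = 0 < A₃`, real values near `a` occur at `a` only: at a real `w ≠ 0` the divided
difference is about `3 A₃ w² > 0`. -/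
lemma eventually_im_ne_zero (h : IsBoundaryInverse a 0 0 A₃ C w) (hA : 0 < A₃) :
    ∀ᶠ x in 𝓝[≠] a, (w x).im ≠ 0 := by
  have hlim := (Continuous.tendsto (f := fun v : ℂ => C * ‖v‖) (by fun_prop) 0).comp h.tendsto
  have hsmall := hlim.eventually_lt_const (u := 3 * A₃) (by simpa using hA)
  filter_upwards [hsmall.filter_mono nhdsWithin_le_nhds, h.slope_le.filter_mono nhdsWithin_le_nhds,
    h.norm_sub_le.filter_mono nhdsWithin_le_nhds, self_mem_nhdsWithin] with x h1 h2 h3 hxa him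
  have hs : 0 < ‖w x‖ := by
    refine norm_pos_iff.2 fun h0 => hxa ?_
    rw [h0] at h3
    norm_num at h3
    rw [sub_eq_zero] at h3
    exact_mod_cast h3
  have hw2 := norm_sq_eq_re_sq_add_im_sq (w x)
  rw [him] at h2 hw2
  simp only [Function.comp] at h1
  have h4 : ‖w x‖ ^ 2 * (C * ‖w x‖) < ‖w x‖ ^ 2 * (3 * A₃) := by gcongr
  nlinarith

/-- If `A₁ = A₂ = 0 < A₃`, then `(Im w)² = 3 (Re w)²` and `x - a = A₃ Re w³` to leading order. Thus
`|Im w| = (√3 / 2) |w|` and `|x - a| = A₃ |w|³`. -/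
lemma isEquivalent (h : IsBoundaryInverse a 0 0 A₃ C w) (hA : 0 < A₃)
    (him : ∀ᶠ x in 𝓝[≠] a, (w x).im ≤ 0) :
    (fun x => -Real.pi⁻¹ * (w x).im) ~[𝓝[≠] a] fun x =>
      Real.sqrt 3 / (2 * Real.pi) * (1 / A₃) ^ (1 / 3 : ℝ) * |x - a| ^ (1 / 3 : ℝ) := by
  have hle : 𝓝[≠] a ≤ 𝓝 a := nhdsWithin_le_nhds
  have hs0 : Tendsto (fun x => ‖w x‖) (𝓝[≠] a) (𝓝 0) := by
    simpa using h.tendsto.norm.mono_left hle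
  have hne := h.eventually_im_ne_zero hA
  have hspos : ∀ᶠ x in 𝓝[≠] a, 0 < ‖w x‖ := by
    filter_upwards [hne] with x hx using norm_pos_iff.2 fun h0 => hx (by simp [h0])
  have hdiff : Tendsto (fun x => 3 * ((w x).re / ‖w x‖) ^ 2 - ((w x).im / ‖w x‖) ^ 2) (𝓝[≠] a)
      (𝓝 0) := by
    have hb : Tendsto (fun x => C / A₃ * ‖w x‖) (𝓝[≠] a) (𝓝 0) := by
      simpa using hs0.const_mul (C / A₃)
    refine squeeze_zero_norm' ?_ hb
    filter_upwards [hne, hspos, h.abs_slope_le.filter_mono hle] with x hx hs habs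
    have h1 := habs hx
    rw [mul_zero, zero_mul, zero_add, zero_add, abs_mul, abs_of_pos hA] at h1
    rw [div_pow, div_pow, ← mul_div_assoc, ← sub_div, Real.norm_eq_abs, abs_div,
      abs_of_pos (pow_pos hs 2), div_mul_eq_mul_div, div_le_div_iff₀ (by positivity) hA]
    linarith
  have hsum : ∀ᶠ x in 𝓝[≠] a, ((w x).re / ‖w x‖) ^ 2 + ((w x).im / ‖w x‖) ^ 2 = 1 := by
    filter_upwards [hspos] with x hs
    rw [div_pow, div_pow, ← add_div, ← norm_sq_eq_re_sq_add_im_sq, div_self (by positivity)]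
  have hre2 : Tendsto (fun x => ((w x).re / ‖w x‖) ^ 2) (𝓝[≠] a) (𝓝 (1 / 4)) := by
    have h1 := (hdiff.add_const 1).div_const 4
    rw [zero_add] at h1
    refine h1.congr' ?_
    filter_upwards [hsum] with x hx
    linarith
  have him2 : Tendsto (fun x => ((w x).im / ‖w x‖) ^ 2) (𝓝[≠] a) (𝓝 (3 / 4)) := by
    have h1 := hre2.const_sub 1
    norm_num at h1
    refine h1.congr' ?_
    filter_upwards [hsum] with x hx
    simp only [div_pow] at hx ⊢
    linarith
  have hre : Tendsto (fun x => |(w x).re / ‖w x‖|) (𝓝[≠] a) (𝓝 (1 / 2)) := by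
    have h1 := hre2.sqrt
    simp only [Real.sqrt_sq_eq_abs] at h1
    convert h1 using 2
    rw [show (1 / 4 : ℝ) = (1 / 2) ^ 2 by norm_num, Real.sqrt_sq (by norm_num)]
  have him1 : Tendsto (fun x => |(w x).im / ‖w x‖|) (𝓝[≠] a) (𝓝 (Real.sqrt 3 / 2)) := by
    have h1 := him2.sqrt
    simp only [Real.sqrt_sq_eq_abs] at h1
    convert h1 using 2
    rw [Real.sqrt_div (by norm_num), show (4 : ℝ) = 2 ^ 2 by norm_num,
      Real.sqrt_sq (by norm_num)]
  have hcube : Tendsto (fun x => |x - a| / ‖w x‖ ^ 3) (𝓝[≠] a) (𝓝 A₃) := by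
    have hmain : Tendsto (fun x => A₃ * (|(w x).re / ‖w x‖|
        * |((w x).re / ‖w x‖) ^ 2 - 3 * ((w x).im / ‖w x‖) ^ 2|)) (𝓝[≠] a) (𝓝 A₃) := by
      have h1 := (hre.mul (hre2.sub (him2.const_mul 3)).abs).const_mul A₃
      norm_num at h1
      simpa only [div_pow, abs_div, abs_norm] using h1
    have herr : Tendsto (fun x => |x - a| / ‖w x‖ ^ 3 - A₃ * (|(w x).re / ‖w x‖|
        * |((w x).re / ‖w x‖) ^ 2 - 3 * ((w x).im / ‖w x‖) ^ 2|)) (𝓝[≠] a) (𝓝 0) := by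
      have hb : Tendsto (fun x => C * ‖w x‖) (𝓝[≠] a) (𝓝 0) := by
        simpa using hs0.const_mul C
      refine squeeze_zero_norm' ?_ hb
      filter_upwards [hspos, h.norm_sub_le.filter_mono hle] with x hs hsub
      have hre := (Complex.abs_re_le_norm _).trans hsub
      have e : ((x : ℂ) - (a + (0 : ℝ) * w x + (0 : ℝ) * w x ^ 2 + A₃ * w x ^ 3)).re
          = x - a - A₃ * ((w x).re * ((w x).re ^ 2 - 3 * (w x).im ^ 2)) := by
        simp [pow_succ]
        ring
      rw [e] at hre
      have e2 : A₃ * (|(w x).re / ‖w x‖| * |((w x).re / ‖w x‖) ^ 2 - 3 * ((w x).im / ‖w x‖) ^ 2|)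
          = |A₃ * ((w x).re * ((w x).re ^ 2 - 3 * (w x).im ^ 2))| / ‖w x‖ ^ 3 := by
        rw [abs_mul, abs_of_pos hA, abs_mul, div_pow, div_pow, ← mul_div_assoc, ← sub_div,
          abs_div, abs_div, abs_of_pos hs, abs_of_pos (pow_pos hs 2)]
        field_simp
      rw [e2, ← sub_div, Real.norm_eq_abs, abs_div, abs_of_pos (pow_pos hs 3),
        div_le_iff₀ (by positivity)]
      calc _ ≤ |x - a - A₃ * ((w x).re * ((w x).re ^ 2 - 3 * (w x).im ^ 2))| :=
            abs_abs_sub_abs_le _ _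
        _ ≤ C * ‖w x‖ ^ 4 := hre
        _ = C * ‖w x‖ * ‖w x‖ ^ 3 := by ring
    simpa using herr.add hmain
  have hroot : Tendsto (fun x => (|x - a| / ‖w x‖ ^ 3) ^ (1 / 3 : ℝ)) (𝓝[≠] a)
      (𝓝 (A₃ ^ (1 / 3 : ℝ))) := hcube.rpow_const (Or.inl hA.ne')
  have hπ := Real.pi_pos
  have h3 : 0 < Real.sqrt 3 := by positivity
  have hA1 : (1 / A₃) ^ (1 / 3 : ℝ) * A₃ ^ (1 / 3 : ℝ) = 1 := by
    rw [← Real.mul_rpow (by positivity) hA.le, one_div_mul_cancel hA.ne', Real.one_rpow]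
  have hquot := (him1.const_mul Real.pi⁻¹).div
    (hroot.const_mul (Real.sqrt 3 / (2 * Real.pi) * (1 / A₃) ^ (1 / 3 : ℝ)))
    (by positivity)
  have hone : Real.pi⁻¹ * (Real.sqrt 3 / 2)
      / (Real.sqrt 3 / (2 * Real.pi) * (1 / A₃) ^ (1 / 3 : ℝ) * A₃ ^ (1 / 3 : ℝ)) = 1 := by
    rw [mul_assoc (Real.sqrt 3 / (2 * Real.pi)), hA1]
    field_simp
  rw [hone] at hquot
  refine (isEquivalent_iff_tendsto_one ?_).2 (hquot.congr' ?_)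
  · filter_upwards [self_mem_nhdsWithin] with x hx
    have : 0 < |x - a| := abs_pos.2 (sub_ne_zero.2 hx)
    positivity
  · filter_upwards [hspos, him, self_mem_nhdsWithin] with x hs hx hxa
    have : 0 < |x - a| := abs_pos.2 (sub_ne_zero.2 hxa)
    have e : (|x - a| / ‖w x‖ ^ 3) ^ (1 / 3 : ℝ) = |x - a| ^ (1 / 3 : ℝ) / ‖w x‖ := by
      rw [Real.div_rpow (by positivity) (by positivity), ← Real.rpow_natCast,
        ← Real.rpow_mul hs.le]
      norm_num
    simp only [Pi.div_apply]
    rw [e, abs_div, abs_of_nonpos hx, abs_of_pos hs]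
    field_simp

end IsBoundaryInverse

/-! ### Cusp points -/

lemma eventually_forall_Ioc {P : ℝ → Prop} {a : ℝ} (h : ∀ᶠ x in 𝓝[>] a, P x) :
    ∀ᶠ δ in 𝓝[>] (0 : ℝ), ∀ x ∈ Set.Ioc a (a + δ), P x := by
  obtain ⟨u, hu, hsub⟩ := mem_nhdsGT_iff_exists_Ioo_subset.1 h
  filter_upwards [Ioo_mem_nhdsGT (sub_pos.2 hu)] with δ hδ x hx
  exact hsub ⟨hx.1, by linarith [hx.2, hδ.2]⟩

lemma eventually_forall_Ico {P : ℝ → Prop} {a : ℝ} (h : ∀ᶠ x in 𝓝[<] a, P x) :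
    ∀ᶠ δ in 𝓝[>] (0 : ℝ), ∀ x ∈ Set.Ico (a - δ) a, P x := by
  obtain ⟨u, hu, hsub⟩ := mem_nhdsLT_iff_exists_Ioo_subset.1 h
  filter_upwards [Ioo_mem_nhdsGT (sub_pos.2 hu)] with δ hδ x hx
  exact hsub ⟨by linarith [hx.1, hδ.2], hx.2⟩

lemma IsCuspPoint.frequently_right {a : ℝ} (h : IsCuspPoint μ a) :
    ∃ᶠ x in 𝓝[>] a, (boundaryCauchy μ x).im ≠ 0 := by
  intro hev
  obtain ⟨δ, ⟨hδ, -, hpos⟩, hδ0⟩ :=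
    (((eventually_forall_Ioc hev).and h.2).and self_mem_nhdsWithin).exists
  refine hpos.ne' ((intervalIntegral.integral_congr (g := fun _ => (0 : ℝ)) fun x hx => ?_).trans
    intervalIntegral.integral_zero)
  rw [Set.uIcc_of_le (by simpa using (Set.mem_Ioi.1 hδ0).le)] at hx
  rcases hx.1.eq_or_lt with rfl | hx0
  · exact h.1
  · have := hδ x ⟨hx0, hx.2⟩
    rw [not_not] at this
    simp [density, this]

lemma IsCuspPoint.frequently_left {a : ℝ} (h : IsCuspPoint μ a) :
    ∃ᶠ x in 𝓝[<] a, (boundaryCauchy μ x).im ≠ 0 := by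
  intro hev
  obtain ⟨δ, ⟨hδ, hpos, -⟩, hδ0⟩ :=
    (((eventually_forall_Ico hev).and h.2).and self_mem_nhdsWithin).exists
  refine hpos.ne' ((intervalIntegral.integral_congr (g := fun _ => (0 : ℝ)) fun x hx => ?_).trans
    intervalIntegral.integral_zero)
  rw [Set.uIcc_of_le (by simpa using (Set.mem_Ioi.1 hδ0).le)] at hx
  rcases hx.2.lt_or_eq with hx0 | rfl
  · have := hδ x ⟨hx.1, hx0⟩
    rw [not_not] at this
    simp [density, this]
  · exact h.1

namespace IsLimitingSpectralLaw

lemma continuousAt_density (hγ : 0 < γ) (hν : IsPopulationLaw ν)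
    (hμ : IsLimitingSpectralLaw γ ν μ) {x : ℝ} (hx : x ≠ 0) : ContinuousAt (density μ) x :=
  continuousAt_const.mul
    (Complex.continuous_im.continuousAt.comp (hμ.continuousAt_boundaryCauchy hγ hν hx))

lemma isCuspPoint_of_eventually (hγ : 0 < γ) (hν : IsPopulationLaw ν)
    (hμ : IsLimitingSpectralLaw γ ν μ) {a : ℝ} (ha : 0 < a) (h0 : (boundaryCauchy μ a).im = 0)
    (hne : ∀ᶠ x in 𝓝[≠] a, (boundaryCauchy μ x).im ≠ 0) : IsCuspPoint μ a := by
  have hpos : ∀ᶠ x in 𝓝[≠] a, 0 < density μ x := by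
    filter_upwards [hne, (eventually_ne_nhds ha.ne').filter_mono nhdsWithin_le_nhds] with x hx hx0
    have h := (hμ.boundaryCauchy_im_nonpos hγ hν hx0).lt_of_ne hx
    have := Real.pi_pos
    exact mul_pos_of_neg_of_neg (by simpa using this) h
  have hr := eventually_forall_Ioc (hpos.filter_mono (nhdsWithin_mono a fun x hx => hx.ne'))
  have hl := eventually_forall_Ico (hpos.filter_mono (nhdsWithin_mono a fun x hx => hx.ne))
  have hint : ∀ b d : ℝ, 0 < b → b ≤ d → IntervalIntegrable (density μ) volume b d := by
    intro b d hb hbd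
    refine ContinuousOn.intervalIntegrable fun x hx => ?_
    rw [Set.uIcc_of_le hbd] at hx
    exact (hμ.continuousAt_density hγ hν (hb.trans_le hx.1).ne').continuousWithinAt
  refine ⟨by simp [density, h0], ?_⟩
  filter_upwards [hr, hl, Ioo_mem_nhdsGT ha] with δ hr hl hδ
  have hδ0 := hδ.1
  have hδa := hδ.2
  exact ⟨intervalIntegral.intervalIntegral_pos_of_pos_on (hint _ _ (by linarith) (by linarith))
      (fun x hx => hl x ⟨hx.1.le, hx.2⟩) (by linarith),
    intervalIntegral.intervalIntegral_pos_of_pos_on (hint _ _ ha (by linarith))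
      (fun x hx => hr x ⟨hx.1, hx.2.le⟩) (by linarith)⟩

/-- At a degenerate critical point the points `c - i r`, for small `r > 0`, are mapped by `G` to the
upper half-plane: there `Im G(c - i r)` is about `poleMoment γ ν c 4 * r ^ 3`. Hence they are values
of the Cauchy transform. -/
lemma boundaryCauchy_eq (hγ : 0 < γ) (hν : IsPopulationLaw ν) (hμ : IsLimitingSpectralLaw γ ν μ)
    {c : ℝ} (hc : c ∈ domainD ν) (h2 : poleMoment γ ν c 2 = 0) (h3 : poleMoment γ ν c 3 = 0) :
    boundaryCauchy μ (g γ ν c) = c := by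
  have h4 := poleMoment_four_pos hγ hν hc h2 h3
  have hlim := hμ.tendsto_boundaryCauchy hγ hν (g_pos_of_poleMoment_two hγ hν hc h2).ne'
  obtain ⟨C, hC, r, hr, hexp⟩ := exists_expansion hγ hν hc
  set w : ℝ → ℂ := fun s => -(s * Complex.I) with hw
  have hw0 : Tendsto w (𝓝[>] 0) (𝓝 0) := by
    have h : Continuous w := by fun_prop
    simpa [hw] using (h.tendsto 0).mono_left nhdsWithin_le_nhds
  have hpair : ∀ᶠ s : ℝ in 𝓝[>] 0, IsInversePair γ ν (c + w s) (inverseMap γ ν (c + w s)) := by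
    have hsmall : 0 < min r (poleMoment γ ν c 4 / C) := by positivity
    filter_upwards [Ioo_mem_nhdsGT hsmall] with s hs
    have hs0 := hs.1
    have hsr := hs.2.le.trans (min_le_left _ _)
    have hsC := hs.2.trans_le (min_le_right _ _)
    rw [lt_div_iff₀' hC] at hsC
    have hnorm : ‖w s‖ = s := by simp [hw, abs_of_pos hs0]
    have him : (c + w s).im = -s := by simp [hw]
    have hP := (abs_le.1 (hexp (w s) (hnorm.trans_le hsr)).2).2
    rw [h2, h3, hnorm] at hP
    simp only [hw, Complex.neg_re, Complex.neg_im, Complex.mul_re, Complex.mul_im,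
      Complex.ofReal_re, Complex.ofReal_im, Complex.I_re, Complex.I_im] at hP
    have hslope : conjSlope γ ν (c + w s) < 0 := by
      have h5 : s ^ 2 * (C * s) < s ^ 2 * poleMoment γ ν c 4 := by gcongr
      simp only [hw]
      nlinarith
    have him' : (c + w s).im < 0 := by linarith
    exact ⟨him', by rw [inverseMap_im hν him'.ne]; exact mul_pos_of_neg_of_neg him' hslope, rfl⟩
  have hG : Tendsto (fun s => inverseMap γ ν (c + w s)) (𝓝[>] 0) (𝓝 (g γ ν c : ℂ)) := by
    have hmain : Tendsto (fun s => (g γ ν c : ℂ) + poleMoment γ ν c 2 * w s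
        + poleMoment γ ν c 3 * w s ^ 2 + poleMoment γ ν c 4 * w s ^ 3) (𝓝[>] 0)
        (𝓝 (g γ ν c : ℂ)) := by
      have := (Continuous.tendsto (f := fun v : ℂ => (g γ ν c : ℂ) + poleMoment γ ν c 2 * v
        + poleMoment γ ν c 3 * v ^ 2 + poleMoment γ ν c 4 * v ^ 3) (by fun_prop) 0).comp hw0
      simpa [Function.comp_def] using this
    have herr : Tendsto (fun s => inverseMap γ ν (c + w s) - ((g γ ν c : ℂ)
        + poleMoment γ ν c 2 * w s + poleMoment γ ν c 3 * w s ^ 2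
        + poleMoment γ ν c 4 * w s ^ 3)) (𝓝[>] 0) (𝓝 0) := by
      have hb : Tendsto (fun s => C * ‖w s‖ ^ 4) (𝓝[>] 0) (𝓝 0) := by
        simpa using (hw0.norm.pow 4).const_mul C
      refine squeeze_zero_norm' ?_ hb
      filter_upwards [hw0.norm.eventually_lt_const (u := r) (by simpa using hr)] with s hs
      exact (hexp (w s) hs.le).1
    simpa using herr.add hmain
  have hG' : Tendsto (fun s => inverseMap γ ν (c + w s)) (𝓝[>] 0)
      (𝓝[upperHalf] (g γ ν c : ℂ)) :=
    tendsto_nhdsWithin_iff.2 ⟨hG, hpair.mono fun s hs => hs.im_pos⟩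
  have hcw : Tendsto (fun s => (c : ℂ) + w s) (𝓝[>] 0) (𝓝 (c : ℂ)) := by
    simpa using hw0.const_add (c : ℂ)
  refine tendsto_nhds_unique (hlim.comp hG') (hcw.congr' ?_)
  filter_upwards [hpair] with s hs
  exact (hμ.cauchyTransform_eq hγ hν hs).symm

lemma cubeRootBehaviour (hγ : 0 < γ) (hν : IsPopulationLaw ν) (hμ : IsLimitingSpectralLaw γ ν μ)
    {c a C : ℝ} (ha : a ≠ 0) (hb : boundaryCauchy μ a = c) (hc : c ∈ domainD ν)
    (h4 : 0 < poleMoment γ ν c 4)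
    (h : IsBoundaryInverse a 0 0 (poleMoment γ ν c 4) C fun x => boundaryCauchy μ x - c) :
    CubeRootBehaviour γ ν μ a c := by
  have him : ∀ᶠ x in 𝓝[≠] a, (boundaryCauchy μ x - c).im ≤ 0 := by
    filter_upwards [(eventually_ne_nhds ha).filter_mono nhdsWithin_le_nhds] with x hx
    simpa using hμ.boundaryCauchy_im_nonpos hγ hν hx
  have heq := h.isEquivalent h4 him
  have hconst : 6 / iteratedDeriv 3 (g γ ν) c = 1 / poleMoment γ ν c 4 := by
    rw [iteratedDeriv_g hν 3 hc]
    norm_num [Nat.factorial]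
    field_simp
  have h0 : density μ a = 0 := by simp [density, hb]
  simp only [Complex.sub_im, Complex.ofReal_im, sub_zero] at heq
  rw [CubeRootBehaviour, hconst, IsEquivalent, ← nhdsNE_sup_pure]
  refine IsLittleO.sup heq ?_
  rw [isLittleO_pure]
  simp [h0]

end IsLimitingSpectralLaw

end WishartCusp

theorem mainTheorem8 (γ : ℝ) (hγ : 0 < γ) (ν μ : MeasureTheory.Measure ℝ)
    (hν : WishartCusp.IsPopulationLaw ν)
    (hμ : WishartCusp.IsLimitingSpectralLaw γ ν μ) :
    (∀ a c : ℝ, WishartCusp.IsCuspPoint μ a →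
      WishartCusp.boundaryCauchy μ a = (c : ℂ) →
      c ∈ WishartCusp.domainD ν →
        WishartCusp.g γ ν c = a ∧
        deriv (WishartCusp.g γ ν) c = 0 ∧
        iteratedDeriv 2 (WishartCusp.g γ ν) c = 0 ∧
        0 < iteratedDeriv 3 (WishartCusp.g γ ν) c ∧
        WishartCusp.CubeRootBehaviour γ ν μ a c) ∧
    (∀ c : ℝ, c ∈ WishartCusp.domainD ν →
      deriv (WishartCusp.g γ ν) c = 0 →
      iteratedDeriv 2 (WishartCusp.g γ ν) c = 0 →
        WishartCusp.IsCuspPoint μ (WishartCusp.g γ ν c) ∧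
        0 < iteratedDeriv 3 (WishartCusp.g γ ν) c ∧
        WishartCusp.CubeRootBehaviour γ ν μ (WishartCusp.g γ ν c) c) := by
  have hd1 : ∀ c ∈ WishartCusp.domainD ν,
      deriv (WishartCusp.g γ ν) c = WishartCusp.poleMoment γ ν c 2 := fun c hc => by
    rw [← iteratedDeriv_one, WishartCusp.iteratedDeriv_g hν 1 hc]
    simp
  have hd2 : ∀ c ∈ WishartCusp.domainD ν,
      iteratedDeriv 2 (WishartCusp.g γ ν) c = 2 * WishartCusp.poleMoment γ ν c 3 :=
    fun c hc => by simp [WishartCusp.iteratedDeriv_g hν 2 hc]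
  have hd3 : ∀ c ∈ WishartCusp.domainD ν, 0 < WishartCusp.poleMoment γ ν c 4 →
      0 < iteratedDeriv 3 (WishartCusp.g γ ν) c := fun c hc h => by
    rw [WishartCusp.iteratedDeriv_g hν 3 hc]
    positivity
  constructor
  · intro a c hcusp hb hc
    have ha := hcusp.ne_zero hγ hν hμ
    obtain ⟨hga, C, hC, h⟩ := hμ.exists_isBoundaryInverse hγ hν ha hb hc
    have hright : ∃ᶠ x in 𝓝[>] a, (WishartCusp.boundaryCauchy μ x - c).im ≠ 0 := by
      simpa using hcusp.frequently_right
    have hleft : ∃ᶠ x in 𝓝[<] a, (WishartCusp.boundaryCauchy μ x - c).im ≠ 0 := by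
      simpa using hcusp.frequently_left
    have h2 := h.coeff_one_eq_zero (hright.filter_mono nhdsWithin_le_nhds)
    rw [h2] at h
    have h3 := h.coeff_two_eq_zero hC hright hleft
    rw [h3] at h
    have h4 := WishartCusp.poleMoment_four_pos hγ hν hc h2 h3
    exact ⟨hga, (hd1 c hc).trans h2, by rw [hd2 c hc, h3, mul_zero], hd3 c hc h4,
      hμ.cubeRootBehaviour hγ hν ha hb hc h4 h⟩
  · intro c hc h2 h3
    rw [hd1 c hc] at h2
    have h3 : WishartCusp.poleMoment γ ν c 3 = 0 := by simpa [hd2 c hc] using h3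
    have h4 := WishartCusp.poleMoment_four_pos hγ hν hc h2 h3
    have ha := WishartCusp.g_pos_of_poleMoment_two hγ hν hc h2
    have hb := hμ.boundaryCauchy_eq hγ hν hc h2 h3
    obtain ⟨-, C, -, h⟩ := hμ.exists_isBoundaryInverse hγ hν ha.ne' hb hc
    rw [h2, h3] at h
    refine ⟨hμ.isCuspPoint_of_eventually hγ hν ha (by simp [hb]) ?_, hd3 c hc h4,
      hμ.cubeRootBehaviour hγ hν ha.ne' hb hc h4 h⟩
    simpa using h.eventually_im_ne_zero h4
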